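/- Let $\mathbb{F}_q$ be a finite field of odd characteristic, $\psi:\mathbb{F}_q\to\mathbb{C}^\times$ a non-trivial additive character, $\sigma$ the quadratic character of $\mathbb{F}_q^\times$, and $G_1=\sum_{z\in\mathbb{F}_q}\psi(\tfrac12 z^2)$. Let $\mathsf{Symp}$ be the category of finite dimensional symplectic vector spaces over $\mathbb{F}_q$ and linear symplectic isomorphisms, with the monoidal structure given by Cartesian product. For $(V,\omega)\in\mathsf{Symp}$ of dimension $2n$ let $H(V)=V\times\mathbb{F}_q$ be the Heisenberg group, with $(v,z)(v',z')=(v+v',z+z'+\tfrac12\omega(v,v'))$. An oriented Lagrangian $L^\circ=(L,o_L)$ is a Lagrangian subspace $L\subset V$ with a non-zero vector $o_L\in\bigwedge^{\mathrm{top}}L$; $\mathcal{H}_{L^\circ}$ is the space of functions $f:H(V)\to\mathbb{C}$ with $f(z\cdot h)=\psi(z)f(h)$ and $f(l\cdot h)=f(h)$ for $z\in\mathbb{F}_q$, $l\in L$, on which $H(V)$ acts by right translation. The canonical system of intertwining morphisms is the unique system of $H(V)$-intertwining maps $F_{M^\circ,L^\circ}:\mathcal{H}_{L^\circ}\to\mathcal{H}_{M^\circ}$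 such that $F_{N^\circ,L^\circ}=F_{N^\circ,M^\circ}\circ F_{M^\circ,L^\circ}$ for all $N^\circ,M^\circ,L^\circ$ and $$F_{M^\circ,L^\circ}[f](h)=(G_1/q)^n\,\sigma\big((-1)^{\binom n2}\omega_\wedge(o_L,o_M)\big)\sum_{m\in M}f(m\cdot h)\quad\text{whenever } L\cap M=0,$$ where $\omega_\wedge(l_1\wedge\dots\wedge l_n,\,m_1\wedge\dots\wedge m_n)=(-1)^{\binom n2}\det(\omega(l_i,m_j))$. Let $\mathcal{H}(V)$ be the space of families $(v_{L^\circ}\in\mathcal{H}_{L^\circ})_{L^\circ}$ with $F_{M^\circ,L^\circ}(v_{L^\circ})=v_{M^\circ}$ for all $M^\circ,L^\circ$. A morphism $f:V\to U$ induces $\mathcal{H}(f):\mathcal{H}(U)\to\mathcal{H}(V)$, $(\mathcal{H}(f)v)_{L^\circ}(x,z)=v_{f(L^\circ)}(f(x),z)$, which makes $\mathcal{H}$ a contravariant functor to finite dimensional complex vector spaces; put $\rho_V(g)=\mathcal{H}(g^{-1})$ for $g\in Sp(V)$. Then the canonical system exists and is unique for every $V\in\mathsf{Symp}$, and there are linear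 isomorphisms $$\alpha_{V_1\times V_2}:\mathcal{H}(V_1\times V_2)\to\mathcal{H}(V_1)\otimes\mathcal{H}(V_2)\qquad(V_1,V_2\in\mathsf{Symp})$$ such that: 1. they are natural: $\alpha_{V_1\times V_2}\circ\mathcal{H}(f_1\times f_2)=(\mathcal{H}(f_1)\otimes\mathcal{H}(f_2))\circ\alpha_{W_1\times W_2}$ for all morphisms $f_i:V_i\to W_i$; 2. they are the structure isomorphisms of a (strong) monoidal structure on the functor $\mathcal{H}$; 3. for all $V_1,V_2$, $\alpha_{V_1\times V_2}$ is an isomorphism of representations of $Sp(V_1)\times Sp(V_2)$ from $(\rho_{V_1\times V_2})_{|Sp(V_1)\times Sp(V_2)}$ to $\rho_{V_1}\otimes\rho_{V_2}$. -/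

import Mathlib

open CategoryTheory MonoidalCategory TensorProduct

/-! ## Symplectic vector spaces -/

/-- A finite dimensional symplectic vector space over `F`. -/
structure SympSpace (F : Type) [Field F] where
  carrier : Type
  [addCommGroup : AddCommGroup carrier]
  [module : Module F carrier]
  [finite : Module.Finite F carrier]
  /-- The symplectic form `ω`. -/
  form : LinearMap.BilinForm F carrier
  alt : form.IsAlt
  nondegenerate : form.Nondegenerate

attribute [instance] SympSpace.addCommGroup SympSpace.module SympSpace.finite

namespace SympSpace

variable {F : Type} [Field F]

instance : CoeSort (SympSpace F) Type := ⟨SympSpace.carrier⟩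

/-- A linear isomorphism of symplectic vector spaces. -/
@[ext]
structure Iso (V W : SympSpace F) where
  toEquiv : V ≃ₗ[F] W
  map_form : ∀ x y : V, W.form (toEquiv x) (toEquiv y) = V.form x y

/-- The (groupoid) category of symplectic vector spaces and linear symplectic isomorphisms. -/
instance : Category (SympSpace F) where
  Hom V W := Iso V W
  id V := ⟨LinearEquiv.refl F V, fun _ _ => rfl⟩
  comp f g := ⟨f.toEquiv.trans g.toEquiv, fun x y => by
    simp [f.map_form, g.map_form]⟩

theorem hom_ext {V W : SympSpace F} {f g : V ⟶ W}
    (h : ∀ x, f.toEquiv x = g.toEquiv x) : f = g :=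
  Iso.ext (LinearEquiv.ext h)

@[simp] theorem id_toEquiv_apply (V : SympSpace F) (x : V) : (𝟙 V : V ⟶ V).toEquiv x = x := rfl

@[simp] theorem comp_toEquiv_apply {V W U : SympSpace F} (f : V ⟶ W) (g : W ⟶ U) (x : V) :
    (f ≫ g).toEquiv x = g.toEquiv (f.toEquiv x) := rfl

/-- The inverse of a symplectic isomorphism. -/
def inv {V W : SympSpace F} (f : V ⟶ W) : W ⟶ V where
  toEquiv := f.toEquiv.symm
  map_form x y := by
    rw [← f.map_form]
    simp

@[simp] theorem inv_comp_self {V W : SympSpace F} (f : V ⟶ W) : inv f ≫ f = 𝟙 W :=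
  hom_ext fun x => f.toEquiv.apply_symm_apply x

@[simp] theorem self_comp_inv {V W : SympSpace F} (f : V ⟶ W) : f ≫ inv f = 𝟙 V :=
  hom_ext fun x => f.toEquiv.symm_apply_apply x

/-- The Cartesian product `V₁ × V₂`, with the form
`ω ((x₁, x₂), (y₁, y₂)) = ω₁ (x₁, y₁) + ω₂ (x₂, y₂)`. -/
def prod (V₁ V₂ : SympSpace F) : SympSpace F where
  carrier := V₁ × V₂
  form := V₁.form.compl₁₂ (LinearMap.fst F V₁ V₂) (LinearMap.fst F V₁ V₂) +
    V₂.form.compl₁₂ (LinearMap.snd F V₁ V₂) (LinearMap.snd F V₁ V₂)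
  alt x := by simp [V₁.alt.self_eq_zero, V₂.alt.self_eq_zero]
  nondegenerate := by
    refine ⟨fun x h => ?_, fun y h => ?_⟩
    · refine Prod.ext (V₁.nondegenerate.1 _ fun y => ?_) (V₂.nondegenerate.1 _ fun y => ?_)
      · simpa using h (y, 0)
      · simpa using h (0, y)
    · refine Prod.ext (V₁.nondegenerate.2 _ fun x => ?_) (V₂.nondegenerate.2 _ fun x => ?_)
      · simpa using h (x, 0)
      · simpa using h (0, x)

@[simp] theorem prod_form_apply (V₁ V₂ : SympSpace F) (x y : V₁ × V₂) :
    (V₁.prod V₂).form x y = V₁.form x.1 y.1 + V₂.form x.2 y.2 := rfl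

/-- The zero symplectic vector space. -/
def zero (F : Type) [Field F] : SympSpace F where
  carrier := PUnit
  form := 0
  alt _ := rfl
  nondegenerate := ⟨fun _ _ => rfl, fun _ _ => rfl⟩

/-- The product `f₁ × f₂` of two symplectic isomorphisms. -/
def prodMap {V₁ V₂ W₁ W₂ : SympSpace F} (f₁ : V₁ ⟶ W₁) (f₂ : V₂ ⟶ W₂) :
    V₁.prod V₂ ⟶ W₁.prod W₂ where
  toEquiv := LinearEquiv.prodCongr f₁.toEquiv f₂.toEquiv
  map_form x y := by
    change W₁.form (f₁.toEquiv x.1) (f₁.toEquiv y.1) +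
      W₂.form (f₂.toEquiv x.2) (f₂.toEquiv y.2) = _
    rw [f₁.map_form, f₂.map_form]
    rfl

@[simp] theorem prodMap_toEquiv_apply {V₁ V₂ W₁ W₂ : SympSpace F} (f₁ : V₁ ⟶ W₁) (f₂ : V₂ ⟶ W₂)
    (x : V₁ × V₂) : (prodMap f₁ f₂).toEquiv x = (f₁.toEquiv x.1, f₂.toEquiv x.2) := rfl

/-- A linear equivalence preserving the forms, as an isomorphism of the category. -/
def mkIso {V W : SympSpace F} (e : V ≃ₗ[F] W)
    (h : ∀ x y, W.form (e x) (e y) = V.form x y) : V ≅ W where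
  hom := ⟨e, h⟩
  inv := inv (⟨e, h⟩ : Iso V W)
  hom_inv_id := self_comp_inv (V := V) (W := W) ⟨e, h⟩
  inv_hom_id := inv_comp_self (V := V) (W := W) ⟨e, h⟩

instance : MonoidalCategoryStruct (SympSpace F) where
  tensorObj := prod
  tensorHom f g := prodMap f g
  whiskerLeft V _ _ f := prodMap (𝟙 V) f
  whiskerRight f V := prodMap f (𝟙 V)
  tensorUnit := zero F
  associator V₁ V₂ V₃ := mkIso (V := (V₁.prod V₂).prod V₃) (W := V₁.prod (V₂.prod V₃))
    (LinearEquiv.prodAssoc F V₁ V₂ V₃) (fun _ _ => (add_assoc _ _ _).symm)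
  leftUnitor V := mkIso (V := (zero F).prod V) (W := V)
    (LinearEquiv.uniqueProd (R := F) (M := V) (M₂ := PUnit)) (fun _ _ => (zero_add _).symm)
  rightUnitor V := mkIso (V := V.prod (zero F)) (W := V)
    (LinearEquiv.prodUnique (R := F) (M := V) (M₂ := PUnit)) (fun _ _ => (add_zero _).symm)

/-- The monoidal structure given by the Cartesian product of symplectic vector spaces. -/
instance : MonoidalCategory (SympSpace F) :=
  MonoidalCategory.ofTensorHom
    (id_tensorHom_id := fun _ _ => rfl)
    (id_tensorHom := fun _ _ _ _ => rfl)
    (tensorHom_id := fun _ _ => rfl)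
    (tensorHom_comp_tensorHom := fun _ _ _ _ => rfl)
    (associator_naturality := fun _ _ _ => rfl)
    (leftUnitor_naturality := fun _ => rfl)
    (rightUnitor_naturality := fun _ => rfl)
    (pentagon := fun _ _ _ _ => rfl)
    (triangle := fun _ _ => rfl)

/-- The symplectic group `Sp(V)`. -/
def Sp (V : SympSpace F) : Subgroup (V ≃ₗ[F] V) where
  carrier := {g | ∀ x y : V, V.form (g x) (g y) = V.form x y}
  mul_mem' {g h} hg hh x y := by
    rw [LinearEquiv.mul_apply, LinearEquiv.mul_apply, hg, hh]
  one_mem' _ _ := rfl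
  inv_mem' {g} hg x y := by
    rw [← hg]
    change V.form (g (g.symm x)) (g (g.symm y)) = _
    simp

/-- An element of `Sp(V)` as an automorphism of `V` in the category. -/
def Sp.toHom {V : SympSpace F} (g : Sp V) : V ⟶ V := ⟨g.1, g.2⟩

/-- The embedding `Sp(V₁) × Sp(V₂) → Sp(V₁ × V₂)`, acting componentwise. -/
def Sp.prod (V₁ V₂ : SympSpace F) : Sp V₁ × Sp V₂ →* Sp (V₁.prod V₂) where
  toFun g := ⟨(prodMap (Sp.toHom g.1) (Sp.toHom g.2)).toEquiv,
    (prodMap (Sp.toHom g.1) (Sp.toHom g.2)).map_form⟩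
  map_one' := rfl
  map_mul' _ _ := rfl

/-! ## The Heisenberg group and its models -/

/-- The Heisenberg group `H(V) = V × F`, with
`(v, z) (v', z') = (v + v', z + z' + ½ ω(v, v'))`. -/
@[ext]
structure Heisenberg (V : SympSpace F) where
  vec : V
  cen : F

namespace Heisenberg

variable {V : SympSpace F}

instance : Mul (Heisenberg V) :=
  ⟨fun h k => ⟨h.vec + k.vec, h.cen + k.cen + 2⁻¹ * V.form h.vec k.vec⟩⟩

instance : One (Heisenberg V) := ⟨⟨0, 0⟩⟩

instance : Inv (Heisenberg V) := ⟨fun h => ⟨-h.vec, -h.cen⟩⟩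

@[simp] theorem mul_vec (h k : Heisenberg V) : (h * k).vec = h.vec + k.vec := rfl

@[simp] theorem mul_cen (h k : Heisenberg V) :
    (h * k).cen = h.cen + k.cen + 2⁻¹ * V.form h.vec k.vec := rfl

@[simp] theorem one_vec : (1 : Heisenberg V).vec = 0 := rfl

@[simp] theorem one_cen : (1 : Heisenberg V).cen = 0 := rfl

@[simp] theorem inv_vec (h : Heisenberg V) : h⁻¹.vec = -h.vec := rfl

@[simp] theorem inv_cen (h : Heisenberg V) : h⁻¹.cen = -h.cen := rfl

instance : Group (Heisenberg V) :=
  Group.ofLeftAxioms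
    (fun a b c => by
      ext
      · simp [add_assoc]
      · simp only [mul_cen, mul_vec, map_add, LinearMap.add_apply]
        ring)
    (fun a => by ext <;> simp)
    (fun a => by ext <;> simp [V.alt.self_eq_zero])

/-- An element `v` of `V`, as the element `(v, 0)` of the Heisenberg group. -/
def ofVec (v : V) : Heisenberg V := ⟨v, 0⟩

/-- An element `z` of `F`, as the element `(0, z)` of the center. -/
def ofCen (z : F) : Heisenberg V := ⟨0, z⟩

@[simp] theorem ofVec_vec (v : V) : (ofVec v).vec = v := rfl

@[simp] theorem ofVec_cen (v : V) : (ofVec v).cen = 0 := rfl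

@[simp] theorem ofCen_vec (z : F) : (ofCen z : Heisenberg V).vec = 0 := rfl

@[simp] theorem ofCen_cen (z : F) : (ofCen z : Heisenberg V).cen = z := rfl

theorem ofCen_mul_comm (z : F) (h : Heisenberg V) : ofCen z * h = h * ofCen z := by
  ext <;> simp [add_comm]

/-- The isomorphism of Heisenberg groups induced by a symplectic isomorphism. -/
def map {W : SympSpace F} (f : V ⟶ W) : Heisenberg V →* Heisenberg W where
  toFun h := ⟨f.toEquiv h.vec, h.cen⟩
  map_one' := by ext <;> simp
  map_mul' h k := by ext <;> simp [f.map_form]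

@[simp] theorem map_vec {W : SympSpace F} (f : V ⟶ W) (h : Heisenberg V) :
    (map f h).vec = f.toEquiv h.vec := rfl

@[simp] theorem map_cen {W : SympSpace F} (f : V ⟶ W) (h : Heisenberg V) :
    (map f h).cen = h.cen := rfl

theorem map_ofVec {W : SympSpace F} (f : V ⟶ W) (v : V) :
    map f (ofVec v) = ofVec (f.toEquiv v) := rfl

theorem map_ofCen {W : SympSpace F} (f : V ⟶ W) (z : F) :
    map f (ofCen z) = ofCen z := by ext <;> simp

theorem map_map_inv {W : SympSpace F} (f : V ⟶ W) (h : Heisenberg W) :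
    map f (map (inv f) h) = h := by
  ext
  · exact f.toEquiv.apply_symm_apply _
  · rfl

theorem map_inv_map {W : SympSpace F} (f : V ⟶ W) (h : Heisenberg V) :
    map (inv f) (map f h) = h := by
  ext
  · exact f.toEquiv.symm_apply_apply _
  · rfl

end Heisenberg

open Heisenberg

/-- The model `ℋ_L`: functions `f` on the Heisenberg group with `f (z h) = ψ(z) f(h)` for
`z` in the center and `f (l h) = f(h)` for `l ∈ L`. -/
def model (ψ : AddChar F ℂ) {V : SympSpace F} (L : Submodule F V) :
    Submodule ℂ (Heisenberg V → ℂ) where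
  carrier := {f | (∀ z h, f (ofCen z * h) = ψ z * f h) ∧ ∀ l ∈ L, ∀ h, f (ofVec l * h) = f h}
  add_mem' {f g} hf hg := by
    refine ⟨fun z h => ?_, fun l hl h => ?_⟩
    · simp only [Pi.add_apply, hf.1, hg.1, mul_add]
    · simp only [Pi.add_apply, hf.2 l hl, hg.2 l hl]
  zero_mem' := ⟨fun _ _ => by simp, fun _ _ _ => rfl⟩
  smul_mem' c f hf := by
    refine ⟨fun z h => ?_, fun l hl h => ?_⟩
    · simp only [Pi.smul_apply, hf.1, smul_eq_mul, mul_left_comm]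
    · simp only [Pi.smul_apply, hf.2 l hl]

/-- The Heisenberg action `π_L` on `ℋ_L` by right translation: `(π_L(h) f)(h') = f(h' h)`. -/
def modelRep (ψ : AddChar F ℂ) {V : SympSpace F} (L : Submodule F V) :
    Representation ℂ (Heisenberg V) (model ψ L) where
  toFun h :=
    { toFun := fun f => ⟨fun k => f.1 (k * h), fun z k => by
          simp only [mul_assoc, f.2.1],
        fun l hl k => by simp only [mul_assoc, f.2.2 l hl]⟩
      map_add' := fun _ _ => rfl
      map_smul' := fun _ _ => rfl }
  map_one' := by
    ext f k
    exact congrArg f.1 (mul_one k)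
  map_mul' h k := by
    ext f x
    exact congrArg f.1 (mul_assoc x h k).symm

/-! ## Oriented Lagrangians and the canonical system of intertwining morphisms -/

/-- An oriented Lagrangian `(L, o)`: a subspace `L` with `L = L^⊥` and a nonzero vector `o` of
`⋀^top L`. Here `⋀^top L` is identified with its image in the exterior algebra of `V`. -/
@[ext]
structure OrientedLagrangian (V : SympSpace F) where
  space : Submodule F V
  lagrangian : V.form.orthogonal space = space
  vec : ExteriorAlgebra F V
  vec_mem : vec ∈ (⋀[F]^(Module.finrank F space) space).map
    (ExteriorAlgebra.map space.subtype).toLinearMap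
  vec_ne_zero : vec ≠ 0

/-- The number `n = dim(V) / 2`. -/
noncomputable def halfDim (V : SympSpace F) : ℕ := Module.finrank F V / 2

theorem map_mem_exteriorPower {M N : Type} [AddCommGroup M] [Module F M] [AddCommGroup N]
    [Module F N] (f : M →ₗ[F] N) {n : ℕ} {x : ExteriorAlgebra F M} (hx : x ∈ ⋀[F]^n M) :
    ExteriorAlgebra.map f x ∈ ⋀[F]^n N := by
  have h : (⋀[F]^n M).map (ExteriorAlgebra.map f).toLinearMap ≤ ⋀[F]^n N := by
    rw [ExteriorAlgebra.exteriorPower, Submodule.map_pow]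
    refine pow_le_pow_left' ?_ n
    rintro _ ⟨_, ⟨m, rfl⟩, rfl⟩
    exact ⟨f m, (ExteriorAlgebra.map_apply_ι f m).symm⟩
  exact h (Submodule.mem_map_of_mem hx)

namespace OrientedLagrangian

variable {V W U : SympSpace F}

theorem form_eq_zero (L : OrientedLagrangian V) {x y : V} (hx : x ∈ L.space) (hy : y ∈ L.space) :
    V.form x y = 0 := by
  rw [← L.lagrangian] at hy
  exact hy x hx

theorem finrank_space (L : OrientedLagrangian V) :
    Module.finrank F L.space = halfDim V := by
  have h := LinearMap.BilinForm.finrank_orthogonal V.nondegenerate L.space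
  have h' := Submodule.finrank_le L.space
  rw [L.lagrangian] at h
  unfold halfDim
  omega

theorem vec_mem_exteriorPower (L : OrientedLagrangian V) : L.vec ∈ ⋀[F]^(halfDim V) V := by
  obtain ⟨x, hx, h⟩ := L.vec_mem
  rw [← h, ← L.finrank_space]
  exact map_mem_exteriorPower _ hx

/-- The orientation vector, as an element of `⋀^n V`. -/
noncomputable def vec' (L : OrientedLagrangian V) : ⋀[F]^(halfDim V) V :=
  ⟨L.vec, L.vec_mem_exteriorPower⟩

instance [Finite F] : Finite (OrientedLagrangian V) := by
  have : Finite V := Module.finite_of_finite F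
  have : Finite (⋀[F]^(halfDim V) V) := Module.finite_of_finite F
  have : Finite (Submodule F V) := Finite.of_injective _ SetLike.coe_injective
  refine Finite.of_injective
    (fun L : OrientedLagrangian V => ((L.space, L.vec') : Submodule F V × ⋀[F]^(halfDim V) V)) ?_
  intro L M h
  exact OrientedLagrangian.ext (congrArg Prod.fst h) (congrArg (fun p => (p.2 : _).1) h)

/-- The image of an oriented Lagrangian under a symplectic isomorphism. -/
noncomputable def map (f : V ⟶ W) (L : OrientedLagrangian V) : OrientedLagrangian W where
  space := L.space.map f.toEquiv.toLinearMap
  lagrangian := by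
    ext y
    obtain ⟨x, rfl⟩ := f.toEquiv.surjective y
    have h1 : f.toEquiv x ∈ L.space.map f.toEquiv.toLinearMap ↔ x ∈ L.space := by simp
    rw [h1]
    nth_rewrite 2 [← L.lagrangian]
    simp only [LinearMap.BilinForm.mem_orthogonal_iff]
    constructor
    · intro h z hz
      exact (f.map_form z x).symm.trans (h _ (Submodule.mem_map_of_mem hz))
    · rintro h _ ⟨z, hz, rfl⟩
      exact (f.map_form z x).trans (h z hz)
  vec := ExteriorAlgebra.map f.toEquiv.toLinearMap L.vec
  vec_mem := by
    obtain ⟨x, hx, h⟩ := L.vec_mem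
    let e := f.toEquiv.submoduleMap L.space
    refine ⟨ExteriorAlgebra.map e.toLinearMap x, ?_, ?_⟩
    · rw [← LinearEquiv.finrank_eq e]
      exact map_mem_exteriorPower _ hx
    · rw [← h]
      change ((ExteriorAlgebra.map _).comp (ExteriorAlgebra.map _)) x =
        ((ExteriorAlgebra.map _).comp (ExteriorAlgebra.map _)) x
      rw [ExteriorAlgebra.map_comp_map, ExteriorAlgebra.map_comp_map]
      rfl
  vec_ne_zero h := by
    apply L.vec_ne_zero
    have := congrArg (ExteriorAlgebra.map f.toEquiv.symm.toLinearMap) h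
    rw [map_zero, ← AlgHom.comp_apply, ExteriorAlgebra.map_comp_map] at this
    simpa using this

theorem map_id (L : OrientedLagrangian V) : map (𝟙 V) L = L := by
  apply OrientedLagrangian.ext
  · exact Submodule.map_id _
  · change ExteriorAlgebra.map LinearMap.id L.vec = L.vec
    simp

theorem map_comp (f : V ⟶ W) (g : W ⟶ U) (L : OrientedLagrangian V) :
    map (f ≫ g) L = map g (map f L) := by
  apply OrientedLagrangian.ext
  · exact Submodule.map_comp _ _ _
  · change ExteriorAlgebra.map (g.toEquiv.toLinearMap ∘ₗ f.toEquiv.toLinearMap) L.vec = _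
    rw [← ExteriorAlgebra.map_comp_map]
    rfl

theorem map_inv_map (f : V ⟶ W) (L : OrientedLagrangian V) : map (inv f) (map f L) = L := by
  rw [← map_comp, self_comp_inv, map_id]

theorem map_map_inv (f : V ⟶ W) (L : OrientedLagrangian W) : map f (map (inv f) L) = L := by
  rw [← map_comp, inv_comp_self, map_id]

end OrientedLagrangian

/-- The pairing of `⋀^n V` with itself induced by the symplectic form, by successive contraction
of adjacent factors of `x₁ ∧ … ∧ xₙ ⊗ y₁ ∧ … ∧ yₙ` (the factor `xₙ` with `y₁`, and so on).
As `pairingDual` takes the value `det (ω(xᵢ, yⱼ))`, this is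
`det (ω(xᵢ, yₙ₊₁₋ⱼ)) = (-1)^(n choose 2) det (ω(xᵢ, yⱼ))`. When the `xᵢ` and the `yⱼ` span
Lagrangian subspaces it is the value of `ω^n / n!` on `x₁ ∧ … ∧ xₙ ∧ y₁ ∧ … ∧ yₙ`
(a Pfaffian). -/
noncomputable def wedgePairing (V : SympSpace F) (n : ℕ) (x y : ⋀[F]^n V) : F :=
  (-1) ^ n.choose 2 * exteriorPower.pairingDual F V n (exteriorPower.map n V.form x) y

theorem wedgePairing_ιMulti (V : SympSpace F) (n : ℕ) (x y : Fin n → V) :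
    wedgePairing V n (exteriorPower.ιMulti F n x) (exteriorPower.ιMulti F n y) =
      (-1) ^ n.choose 2 * (Matrix.of fun i j => V.form (x i) (y j)).det := by
  rw [wedgePairing, exteriorPower.map_apply_ιMulti, exteriorPower.pairingDual_ιMulti_ιMulti,
    ← Matrix.det_transpose]
  rfl

/-- The one-dimensional Gauss sum `G₁ = ∑_z ψ(z² / 2)`. -/
noncomputable def gaussSum₁ [Fintype F] (ψ : AddChar F ℂ) : ℂ := ∑ z : F, ψ (2⁻¹ * z ^ 2)

/-- The normalization constant
`C_{M,L} = (G₁ / q)^n σ((-1)^(n choose 2) ω_∧(o_L, o_M))`, where `σ` is the quadratic character. -/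
noncomputable def normConst [Fintype F] [DecidableEq F] (ψ : AddChar F ℂ) {V : SympSpace F}
    (M L : OrientedLagrangian V) : ℂ :=
  (gaussSum₁ ψ / Fintype.card F) ^ halfDim V *
    (quadraticChar F
      ((-1) ^ (halfDim V).choose 2 * wedgePairing V (halfDim V) L.vec' M.vec') : ℤ)

/-- The averaging morphism `f ↦ (h ↦ ∑_{m ∈ M} f(m h))` from `ℋ_L` to `ℋ_M`. -/
noncomputable def averaging [Finite F] (ψ : AddChar F ℂ) {V : SympSpace F}
    (M L : OrientedLagrangian V) : model ψ L.space →ₗ[ℂ] model ψ M.space where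
  toFun f := ⟨fun h => ∑ᶠ m : M.space, f.1 (ofVec m.1 * h), by
    have : Finite V := Module.finite_of_finite F
    refine ⟨fun z h => ?_, fun l hl h => ?_⟩
    · change ∑ᶠ m : M.space, f.1 (ofVec m.1 * (ofCen z * h)) =
        ψ z * ∑ᶠ m : M.space, f.1 (ofVec m.1 * h)
      rw [← smul_eq_mul (a := ψ z), smul_finsum]
      refine finsum_congr fun m => ?_
      rw [← mul_assoc, ← ofCen_mul_comm, mul_assoc, f.2.1, smul_eq_mul]
    · change ∑ᶠ m : M.space, f.1 (ofVec m.1 * (ofVec l * h)) =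
        ∑ᶠ m : M.space, f.1 (ofVec m.1 * h)
      refine Eq.trans (finsum_congr fun m => ?_)
        (finsum_comp_equiv (Equiv.addRight (⟨l, hl⟩ : M.space)))
      rw [← mul_assoc]
      refine congrArg (fun w => f.1 (w * h)) (Heisenberg.ext ?_ ?_)
      · simp
      · simp [M.form_eq_zero m.2 hl]⟩
  map_add' f g := by
    have : Finite V := Module.finite_of_finite F
    refine Subtype.ext (funext fun h => ?_)
    exact finsum_add_distrib (Set.toFinite _) (Set.toFinite _)
  map_smul' c f := by
    refine Subtype.ext (funext fun h => ?_)
    exact (smul_finsum c _).symm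

/-- The predicate characterizing the canonical system `{F_{M,L} ∈ Hom_H(ℋ_L, ℋ_M)}` of
intertwining morphisms: every `F_{M,L}` commutes with the Heisenberg action, `F_{M,L}` is the
normalized averaging morphism when `L ∩ M = 0`, and the system is multiplicative. -/
structure IsCanonicalSystem [Fintype F] [DecidableEq F] (ψ : AddChar F ℂ) (V : SympSpace F)
    (T : ∀ M L : OrientedLagrangian V, model ψ L.space →ₗ[ℂ] model ψ M.space) : Prop where
  intertwining : ∀ (M L : OrientedLagrangian V) (h : Heisenberg V),
    T M L ∘ₗ modelRep ψ L.space h = modelRep ψ M.space h ∘ₗ T M L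
  restriction : ∀ M L : OrientedLagrangian V, L.space ⊓ M.space = ⊥ →
    T M L = normConst ψ M L • averaging ψ M L
  multiplicative : ∀ N M L : OrientedLagrangian V, T N L = T N M ∘ₗ T M L

/-! ## The canonical vector space -/

/-- The canonical vector space `ℋ(V)`: the families `(v_L ∈ ℋ_L)`, indexed by the oriented
Lagrangians, with `F_{M,L} v_L = v_M` for all `M`, `L`, where `F` is the canonical system. -/
def canonicalSpace [Fintype F] [DecidableEq F] (ψ : AddChar F ℂ) (V : SympSpace F) :
    Submodule ℂ (∀ L : OrientedLagrangian V, model ψ L.space) where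
  carrier := {v | ∀ T, IsCanonicalSystem ψ V T → ∀ M L, T M L (v L) = v M}
  add_mem' {v w} hv hw T hT M L := by
    rw [Pi.add_apply, map_add, hv T hT, hw T hT, Pi.add_apply]
  zero_mem' _ _ _ _ := map_zero _
  smul_mem' c v hv T hT M L := by
    rw [Pi.smul_apply, map_smul, hv T hT, Pi.smul_apply]

instance [Fintype F] [DecidableEq F] (ψ : AddChar F ℂ) (V : SympSpace F) :
    Module.Finite ℂ (canonicalSpace ψ V) := by
  have : Finite V := Module.finite_of_finite F
  have : Finite (Heisenberg V) :=
    Finite.of_injective (fun h : Heisenberg V => (h.vec, h.cen))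
      fun h k e => Heisenberg.ext (congrArg Prod.fst e) (congrArg Prod.snd e)
  infer_instance

/-! ## The quantization functor -/

theorem comp_map_mem_model {ψ : AddChar F ℂ} {V W : SympSpace F} (f : V ⟶ W) {L : Submodule F V}
    {u : Heisenberg W → ℂ} (hu : u ∈ model ψ (L.map f.toEquiv.toLinearMap)) :
    (fun h => u (Heisenberg.map f h)) ∈ model ψ L := by
  refine ⟨fun z h => ?_, fun l hl h => ?_⟩
  · simp only [map_mul, map_ofCen, hu.1]
  · simp only [map_mul, map_ofVec]
    exact hu.2 _ (Submodule.mem_map_of_mem hl) _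

/-- The pull-back `ℋ_{f(L)}(W) → ℋ_L(V)` along a symplectic isomorphism `f : V → W`. -/
def pullback (ψ : AddChar F ℂ) {V W : SympSpace F} (f : V ⟶ W) (L : OrientedLagrangian V) :
    model ψ (L.map f).space →ₗ[ℂ] model ψ L.space where
  toFun u := ⟨fun h => u.1 (Heisenberg.map f h), comp_map_mem_model f u.2⟩
  map_add' _ _ := rfl
  map_smul' _ _ := rfl

/-- The pull-back `ℋ_L(W) → ℋ_{f⁻¹(L)}(V)` along a symplectic isomorphism `f : V → W`. -/
def pullback' (ψ : AddChar F ℂ) {V W : SympSpace F} (f : V ⟶ W) (L : OrientedLagrangian W) :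
    model ψ L.space →ₗ[ℂ] model ψ (L.map (inv f)).space where
  toFun u := ⟨fun h => u.1 (Heisenberg.map f h), comp_map_mem_model f (by
    have h := congrArg OrientedLagrangian.space (OrientedLagrangian.map_map_inv f L)
    change (L.map (inv f)).space.map f.toEquiv.toLinearMap = L.space at h
    rw [h]
    exact u.2)⟩
  map_add' _ _ := rfl
  map_smul' _ _ := rfl

theorem halfDim_eq {V W : SympSpace F} (f : V ⟶ W) : halfDim V = halfDim W := by
  unfold halfDim
  rw [f.toEquiv.finrank_eq]

theorem wedgePairing_map {V W : SympSpace F} (f : V ⟶ W) (n : ℕ) (x y : ⋀[F]^n V) :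
    wedgePairing W n (exteriorPower.map n f.toEquiv.toLinearMap x)
      (exteriorPower.map n f.toEquiv.toLinearMap y) = wedgePairing V n x y := by
  unfold wedgePairing
  congr 1
  let A : ⋀[F]^n V →ₗ[F] Module.Dual F (⋀[F]^n V) :=
    (Module.Dual.transpose (exteriorPower.map n f.toEquiv.toLinearMap)) ∘ₗ
      exteriorPower.pairingDual F W n ∘ₗ exteriorPower.map n W.form ∘ₗ
        exteriorPower.map n f.toEquiv.toLinearMap
  let B : ⋀[F]^n V →ₗ[F] Module.Dual F (⋀[F]^n V) :=
    exteriorPower.pairingDual F V n ∘ₗ exteriorPower.map n V.form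
  have h : A = B := by
    ext a b
    simp only [A, B, LinearMap.compAlternatingMap_apply, LinearMap.comp_apply,
      exteriorPower.map_apply_ιMulti, Module.Dual.transpose_apply,
      exteriorPower.pairingDual_ιMulti_ιMulti]
    congr 1
    ext i j
    exact f.map_form _ _
  exact LinearMap.congr_fun (LinearMap.congr_fun h x) y

theorem coe_exteriorPower_map {M N : Type} [AddCommGroup M] [Module F M] [AddCommGroup N]
    [Module F N] (f : M →ₗ[F] N) (n : ℕ) (x : ⋀[F]^n M) :
    (exteriorPower.map n f x : ExteriorAlgebra F N) = ExteriorAlgebra.map f x := by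
  have h : (⋀[F]^n N).subtype ∘ₗ exteriorPower.map n f =
      (ExteriorAlgebra.map f).toLinearMap ∘ₗ (⋀[F]^n M).subtype := by
    ext a
    simp
  exact LinearMap.congr_fun h x

theorem normConst_map [Fintype F] [DecidableEq F] (ψ : AddChar F ℂ) {V W : SympSpace F}
    (f : V ⟶ W) (M L : OrientedLagrangian V) :
    normConst ψ (M.map f) (L.map f) = normConst ψ M L := by
  have key : ∀ n (hn : n = halfDim V) (a b : ⋀[F]^n W),
      a.1 = ExteriorAlgebra.map f.toEquiv.toLinearMap L.vec →
      b.1 = ExteriorAlgebra.map f.toEquiv.toLinearMap M.vec →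
      wedgePairing W n a b = wedgePairing V (halfDim V) L.vec' M.vec' := by
    rintro n rfl a b ha hb
    rw [← wedgePairing_map f]
    congr 1
    · exact Subtype.ext (ha.trans (coe_exteriorPower_map f.toEquiv.toLinearMap _ (L.vec')).symm)
    · exact Subtype.ext (hb.trans (coe_exteriorPower_map f.toEquiv.toLinearMap _ (M.vec')).symm)
  unfold normConst
  rw [key (halfDim W) (halfDim_eq f).symm (L.map f).vec' (M.map f).vec' rfl rfl,
    ← halfDim_eq f]

/-- The transport of a system of morphisms along a symplectic isomorphism. -/
noncomputable def transport (ψ : AddChar F ℂ) {V W : SympSpace F} (f : V ⟶ W)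
    (T : ∀ M L : OrientedLagrangian V, model ψ L.space →ₗ[ℂ] model ψ M.space)
    (M L : OrientedLagrangian W) : model ψ L.space →ₗ[ℂ] model ψ M.space :=
  pullback ψ (inv f) M ∘ₗ T (M.map (inv f)) (L.map (inv f)) ∘ₗ pullback' ψ f L

theorem IsCanonicalSystem.transport [Fintype F] [DecidableEq F] {ψ : AddChar F ℂ}
    {V W : SympSpace F} (f : V ⟶ W)
    {T : ∀ M L : OrientedLagrangian V, model ψ L.space →ₗ[ℂ] model ψ M.space}
    (hT : IsCanonicalSystem ψ V T) : IsCanonicalSystem ψ W (transport ψ f T) where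
  intertwining M L h := by
    refine LinearMap.ext fun u => ?_
    have h1 : pullback' ψ f L (modelRep ψ L.space h u) =
        modelRep ψ _ (Heisenberg.map (inv f) h) (pullback' ψ f L u) := by
      refine Subtype.ext (funext fun k => ?_)
      change u.1 (Heisenberg.map f k * h) = u.1 (Heisenberg.map f (k * Heisenberg.map (inv f) h))
      rw [map_mul, map_map_inv]
    have h2 := LinearMap.congr_fun (hT.intertwining (M.map (inv f)) (L.map (inv f))
      (Heisenberg.map (inv f) h)) (pullback' ψ f L u)
    refine Subtype.ext (funext fun k => ?_)
    change (T _ _ (pullback' ψ f L (modelRep ψ L.space h u))).1 (Heisenberg.map (inv f) k) =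
      (T _ _ (pullback' ψ f L u)).1 (Heisenberg.map (inv f) (k * h))
    rw [h1, map_mul]
    exact congrFun (congrArg Subtype.val h2) (Heisenberg.map (inv f) k)
  restriction M L hML := by
    have h0 : (L.map (inv f)).space ⊓ (M.map (inv f)).space = ⊥ := by
      change L.space.map (inv f).toEquiv.toLinearMap ⊓ M.space.map (inv f).toEquiv.toLinearMap = ⊥
      rw [← Submodule.map_inf _ (inv f).toEquiv.injective, hML, Submodule.map_bot]
    unfold SympSpace.transport
    rw [hT.restriction _ _ h0, normConst_map]
    refine LinearMap.ext fun u => Subtype.ext (funext fun h => ?_)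
    change normConst ψ M L * ∑ᶠ m : (M.map (inv f)).space,
      u.1 (Heisenberg.map f (ofVec m.1 * Heisenberg.map (inv f) h)) =
      normConst ψ M L * ∑ᶠ m : M.space, u.1 (ofVec m.1 * h)
    congr 1
    refine (finsum_comp_equiv ((inv f).toEquiv.submoduleMap M.space).toEquiv).symm.trans ?_
    refine finsum_congr fun m => ?_
    rw [map_mul, map_map_inv, map_ofVec]
    exact congrArg (fun w => u.1 (ofVec w * h)) (f.toEquiv.apply_symm_apply m.1)
  multiplicative N M L := by
    refine LinearMap.ext fun u => ?_
    have h1 : ∀ w, pullback' ψ f M (pullback ψ (inv f) M w) = w := fun w =>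
      Subtype.ext (funext fun k => congrArg w.1 (map_inv_map f k))
    change pullback ψ (inv f) N (T _ _ _) = pullback ψ (inv f) N
      (T _ _ (pullback' ψ f M (pullback ψ (inv f) M (T _ _ _))))
    rw [h1, hT.multiplicative _ (M.map (inv f))]
    rfl

section Functor

variable [Fintype F] [DecidableEq F] (ψ : AddChar F ℂ)

theorem pullback_mem_canonicalSpace {V W : SympSpace F} (f : V ⟶ W) (v : canonicalSpace ψ W) :
    (fun L => pullback ψ f L (v.1 (L.map f))) ∈ canonicalSpace ψ V := by
  intro T hT M L
  have h := v.2 _ (hT.transport f) (M.map f) (L.map f)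
  have key : ∀ (M' L' : OrientedLagrangian V), M' = M → L' = L → ∀ (a : model ψ L'.space)
      (b : model ψ L.space), a.1 = b.1 → (T M' L' a).1 = (T M L b).1 := by
    rintro M' L' rfl rfl a b hab
    rw [Subtype.ext hab]
  change T M L (pullback ψ f L (v.1 (L.map f))) = pullback ψ f M (v.1 (M.map f))
  rw [← h]
  refine Subtype.ext (funext fun k => ?_)
  change _ = (T _ _ (pullback' ψ f (L.map f) (v.1 (L.map f)))).1
    (Heisenberg.map (inv f) (Heisenberg.map f k))
  rw [map_inv_map]
  exact (congrFun (key _ _ (M.map_inv_map f) (L.map_inv_map f) _ _ rfl) k).symm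

/-- The map `ℋ(f) : ℋ(W) → ℋ(V)` induced by a symplectic isomorphism `f : V → W`:
`(ℋ(f) v)_L = f^* v_{f(L)}`. -/
noncomputable def canonicalMap {V W : SympSpace F} (f : V ⟶ W) :
    canonicalSpace ψ W →ₗ[ℂ] canonicalSpace ψ V where
  toFun v := ⟨fun L => pullback ψ f L (v.1 (L.map f)), pullback_mem_canonicalSpace ψ f v⟩
  map_add' _ _ := rfl
  map_smul' _ _ := rfl

theorem canonicalMap_id (V : SympSpace F) : canonicalMap ψ (𝟙 V) = LinearMap.id := by
  refine LinearMap.ext fun v => Subtype.ext (funext fun L => Subtype.ext (funext fun k => ?_))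
  have key : ∀ L' : OrientedLagrangian V, L' = L → (v.1 L').1 k = (v.1 L).1 k := by
    rintro L' rfl
    rfl
  exact key _ L.map_id

theorem canonicalMap_comp {V W U : SympSpace F} (f : V ⟶ W) (g : W ⟶ U) :
    canonicalMap ψ (f ≫ g) = canonicalMap ψ f ∘ₗ canonicalMap ψ g := by
  refine LinearMap.ext fun v => Subtype.ext (funext fun L => Subtype.ext (funext fun k => ?_))
  have key : ∀ (L₁ L₂ : OrientedLagrangian U) (x : Heisenberg U), L₁ = L₂ →
      (v.1 L₁).1 x = (v.1 L₂).1 x := by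
    rintro L₁ L₂ x rfl
    rfl
  exact key _ _ _ (OrientedLagrangian.map_comp f g L)

/-- The (contravariant) quantization functor `V ↦ ℋ(V)`, from symplectic vector spaces to finite
dimensional complex vector spaces. -/
noncomputable def quantization : (SympSpace F)ᵒᵖ ⥤ FGModuleCat ℂ where
  obj V := FGModuleCat.of ℂ (canonicalSpace ψ V.unop)
  map f := FGModuleCat.ofHom (canonicalMap ψ f.unop)
  map_id V := by
    refine FGModuleCat.hom_ext ?_
    exact canonicalMap_id ψ V.unop
  map_comp f g := by
    refine FGModuleCat.hom_ext ?_
    exact canonicalMap_comp ψ g.unop f.unop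

/-- The canonical model `ρ_V` of the Weil representation of `Sp(V)` on `ℋ(V)`:
`ρ_V(g) = ℋ(g⁻¹)`. -/
noncomputable def weilRep (V : SympSpace F) : Representation ℂ (Sp V) (canonicalSpace ψ V) where
  toFun g := canonicalMap ψ (Sp.toHom g⁻¹)
  map_one' := by
    rw [inv_one]
    exact canonicalMap_id ψ V
  map_mul' g h := by
    rw [mul_inv_rev]
    exact canonicalMap_comp ψ (Sp.toHom g⁻¹) (Sp.toHom h⁻¹)

end Functor

end SympSpace

/-! The canonical system is built by passing through a common complement. If `N` is a complement of
both `L` and `M`, let `φ : L → M` be the identification along `N`, so `φ l - l ∈ N`. Then `B(l, l')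
= ω(l, φ l')` is a symmetric form on `L` with kernel `L ∩ M`. Completing the square in the
Heisenberg group gives `|L ∩ M| A_{M,N} A_{N,L} = G(B) A_{M,L}` for the averaging maps, where `G(B)`
is the Gauss sum of `B` (`averaging_comp_averaging`). Everything then depends on how this Gauss sum
varies with `N`.

Replacing `N` by `N'` replaces `φ` by `φ ∘ S` and `B` by `B(·, S ·)`, which multiplies `G(B)` by
`σ(det S)` (`formGaussSum_twist`). The normalizing constants change by the same sign, so `F_{M,N}
F_{N,L}` does not depend on `N` (`normAveraging_comp_eq`). It equals the prescribed map when `L ∩ M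
= 0`, and it is the identity when `L = M`. Any three Lagrangians have a common complement, because
in odd characteristic a vector space is not a union of three proper subspaces; multiplicativity
follows. Uniqueness holds because multiplicativity and the transverse values determine every
`F_{M,L}`.

For the monoidal structure, evaluation at a single `L` identifies `ℋ(V)` with `ℋ_L`. The external
product `f ⊠ g` of model functions identifies `ℋ_{L₁} ⊗ ℋ_{L₂}` with `ℋ_{L₁ × L₂}`, where `L₁ × L₂`
is oriented by `o₁ ∧ o₂`. Averaging and the normalizing constants are both multiplicative for
products, so `⊠` commutes with the canonical systems (`canonicalSystem_box`) and induces an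
isomorphism `ℋ(V₁) ⊗ ℋ(V₂) ≃ ℋ(V₁ × V₂)`. Its inverse is `α`. Naturality and coherence are checked
on pure tensors at one product Lagrangian, where they become identities between products of function
values. The statement on Weil representations is naturality for automorphisms. -/

namespace SympSpace

/-! ### Quadratic Gauss sums, of one variable and of symmetric bilinear forms. -/

section GaussSums

variable {F : Type} [Field F] [Fintype F] [DecidableEq F]

/-- The quadratic character with complex values. -/
noncomputable abbrev quadChar (F : Type) [Field F] [Fintype F] [DecidableEq F] : MulChar F ℂ :=
  (quadraticChar F).ringHomComp (Int.castRingHom ℂ)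

theorem quadChar_ne_one (hF : ringChar F ≠ 2) : quadChar F ≠ 1 := by
  intro h
  obtain ⟨a, ha⟩ := quadraticChar_exists_neg_one' hF
  have := congrArg (fun χ : MulChar F ℂ => χ a) h
  simp [MulChar.ringHomComp_apply, ha] at this
  norm_num at this

theorem quadChar_isQuadratic : (quadChar F).IsQuadratic :=
  MulChar.IsQuadratic.comp (quadraticChar_isQuadratic F) _

theorem quadChar_mul_self {a : F} (ha : a ≠ 0) : quadChar F a * quadChar F a = 1 := by
  have h := quadraticChar_sq_one ha
  rw [MulChar.ringHomComp_apply, ← map_mul, ← sq, h, map_one]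

/-- An element `y` has `σ(y) + 1` square roots, and the summand `1` contributes `∑ ψ(a y) = 0`. What
is left is the Gauss sum of `σ` for the shifted character. -/
theorem sum_addChar_sq (hF : ringChar F ≠ 2) {ψ : AddChar F ℂ} (hψ : ψ ≠ 1) {a : F} (ha : a ≠ 0) :
    ∑ z : F, ψ (a * z ^ 2) = quadChar F a * gaussSum (quadChar F) ψ := by
  have h0 : ∑ y : F, ψ (a * y) = 0 :=
    AddChar.sum_eq_zero_of_ne_one (ψ := ψ.mulShift a) (AddChar.IsPrimitive.of_ne_one hψ ha)
  have h1 : ∑ z : F, ψ (a * z ^ 2) = ∑ y : F, (quadChar F y + 1) * ψ (a * y) := by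
    rw [← Finset.sum_fiberwise (Finset.univ : Finset F) (fun z => z ^ 2)]
    refine Finset.sum_congr rfl fun y _ => ?_
    have h2 := quadraticChar_card_sqrts hF y
    have h3 : ({x : F | x ^ 2 = y} : Set F).toFinset = Finset.univ.filter fun z => z ^ 2 = y := by
      ext; simp
    rw [h3] at h2
    rw [Finset.sum_congr rfl (g := fun _ => ψ (a * y)), Finset.sum_const, nsmul_eq_mul]
    · congr 1
      have := congrArg (Int.cast : ℤ → ℂ) h2
      simpa [MulChar.ringHomComp_apply] using this
    · intro z hz
      rw [(Finset.mem_filter.1 hz).2]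
  have h2 := gaussSum_mulShift (quadChar F) ψ (Units.mk0 a ha)
  rw [h1]
  simp only [add_mul, one_mul, Finset.sum_add_distrib, h0, add_zero]
  rw [← h2, ← mul_assoc, Units.val_mk0, quadChar_mul_self ha, one_mul]
  rfl

theorem sum_addChar_half_mul_sq (hF : ringChar F ≠ 2) {ψ : AddChar F ℂ} (hψ : ψ ≠ 1) {d : F}
    (hd : d ≠ 0) : ∑ z : F, ψ (2⁻¹ * (d * z ^ 2)) = quadChar F d * gaussSum₁ ψ := by
  have h2 : (2 : F)⁻¹ ≠ 0 := inv_ne_zero (Ring.two_ne_zero hF)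
  unfold gaussSum₁
  simp_rw [← mul_assoc]
  rw [sum_addChar_sq hF hψ (mul_ne_zero h2 hd), sum_addChar_sq hF hψ h2, map_mul]
  ring

/-- `G₁` is `σ(1/2)` times the classical Gauss sum, and this sign disappears on squaring. -/
theorem gaussSum₁_sq (hF : ringChar F ≠ 2) {ψ : AddChar F ℂ} (hψ : ψ ≠ 1) :
    gaussSum₁ ψ ^ 2 = quadChar F (-1) * Fintype.card F := by
  have h2 : (2 : F)⁻¹ ≠ 0 := inv_ne_zero (Ring.two_ne_zero hF)
  unfold gaussSum₁
  rw [sum_addChar_sq hF hψ h2, mul_pow, sq (quadChar F 2⁻¹), quadChar_mul_self h2, one_mul,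
    gaussSum_sq (quadChar_ne_one hF) quadChar_isQuadratic (AddChar.IsPrimitive.of_ne_one hψ)]

/-- The Gauss sum `∑ ψ(B(x, x) / 2)` of a bilinear form. -/
noncomputable def formGaussSum {F : Type} [Field F] (ψ : AddChar F ℂ) {X : Type}
    [AddCommGroup X] [Module F X] [Fintype X] (B : LinearMap.BilinForm F X) : ℂ := ∑ x : X, ψ (2⁻¹ * B x x)

theorem addChar_map_sum {F : Type} [Field F] {ι : Type*} (s : Finset ι) (ψ : AddChar F ℂ)
    (f : ι → F) :
    ψ (∑ i ∈ s, f i) = ∏ i ∈ s, ψ (f i) :=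
  map_prod ψ.toMonoidHom (fun i => Multiplicative.ofAdd (f i)) s

/-- In an orthogonal basis the sum factors into one-variable Gauss sums. -/
theorem formGaussSum_eq {X : Type} [AddCommGroup X] [Module F X] [Fintype X] (hF : ringChar F ≠ 2)
    {ψ : AddChar F ℂ} (hψ : ψ ≠ 1) {ι : Type} [Fintype ι] [DecidableEq ι]
    (b : Module.Basis ι F X) (B : LinearMap.BilinForm F X)
    (hs : B.IsSymm) (hB : B.Nondegenerate) :
    formGaussSum ψ B =
      quadChar F (LinearMap.BilinForm.toMatrix b B).det * gaussSum₁ ψ ^ Fintype.card ι := by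
  have : Invertible (2 : F) := invertibleOfNonzero (Ring.two_ne_zero hF)
  obtain ⟨v₀, hv₀⟩ := LinearMap.BilinForm.exists_orthogonal_basis
    (LinearMap.BilinForm.isSymm_iff.1 hs)
  let e : Fin (Module.finrank F X) ≃ ι := Fintype.equivOfCardEq (by
    rw [Fintype.card_fin, Module.finrank_eq_card_basis b])
  let v := v₀.reindex e
  have hv : ∀ i j, i ≠ j → B (v i) (v j) = 0 := fun i j hij => by
    simp only [v, Module.Basis.reindex_apply]
    exact hv₀ (fun h => hij (e.symm.injective h))
  let d : ι → F := fun i => B (v i) (v i)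
  have hM : LinearMap.BilinForm.toMatrix v B = Matrix.diagonal d := by
    ext i j
    rw [LinearMap.BilinForm.toMatrix_apply, Matrix.diagonal_apply]
    split_ifs with h
    · rw [h]
    · exact hv i j h
  have hdet : (LinearMap.BilinForm.toMatrix v B).det ≠ 0 :=
    (LinearMap.BilinForm.nondegenerate_iff_det_ne_zero v).1 hB
  have hd : ∀ i, d i ≠ 0 := by
    rw [hM, Matrix.det_diagonal, Finset.prod_ne_zero_iff] at hdet
    exact fun i => hdet i (Finset.mem_univ i)
  have hb : (v.toMatrix b).det ≠ 0 := by
    have := v.toMatrix_mul_toMatrix_flip b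
    intro h
    have h1 := congrArg Matrix.det this
    rw [Matrix.det_mul, h, zero_mul, Matrix.det_one] at h1
    exact zero_ne_one h1
  -- A change of basis multiplies the Gram determinant by a nonzero square, which `σ` does not see.
  have hdet' : quadChar F (LinearMap.BilinForm.toMatrix b B).det =
      quadChar F (LinearMap.BilinForm.toMatrix v B).det := by
    rw [← LinearMap.BilinForm.toMatrix_mul_basis_toMatrix v b B, Matrix.det_mul, Matrix.det_mul,
      Matrix.det_transpose, map_mul, map_mul, mul_right_comm, quadChar_mul_self hb, one_mul]
  rw [hdet', hM, Matrix.det_diagonal]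
  have hq : ∀ c : ι → F, B (v.equivFun.symm c) (v.equivFun.symm c) = ∑ i, d i * c i ^ 2 := by
    intro c
    rw [Module.Basis.equivFun_symm_apply]
    simp only [map_sum, LinearMap.sum_apply, map_smul, LinearMap.smul_apply, smul_eq_mul]
    refine Finset.sum_congr rfl fun i _ => ?_
    rw [Finset.sum_eq_single i]
    · simp only [d]; ring
    · intro j _ hj
      rw [hv j i hj]; ring
    · simp
  unfold formGaussSum
  rw [← Equiv.sum_comp v.equivFun.symm.toEquiv]
  change ∑ c : ι → F, ψ (2⁻¹ * B (v.equivFun.symm c) (v.equivFun.symm c)) = _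
  simp_rw [hq, Finset.mul_sum, addChar_map_sum]
  rw [← Fintype.piFinset_univ, ← Finset.prod_univ_sum (fun _ => Finset.univ)
    (fun i z => ψ (2⁻¹ * (d i * z ^ 2)))]
  simp_rw [sum_addChar_half_mul_sq hF hψ (hd _)]
  rw [Finset.prod_mul_distrib, Finset.prod_const, Finset.card_univ, map_prod]

theorem formGaussSum_zero {F : Type} [Field F] {X : Type} [AddCommGroup X] [Module F X]
    [Fintype X] (ψ : AddChar F ℂ) :
    formGaussSum ψ (0 : LinearMap.BilinForm F X) = Fintype.card X := by
  simp [formGaussSum]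

/-- The common kernel `K` only contributes a factor `|K|`, so the comparison takes place on a
complement `C`, where both forms are nondegenerate. `S` need not preserve `C`. It fixes `K`
pointwise, however, and the `K`-component of `S c` is invisible to `B₁`. -/
theorem formGaussSum_twist {X : Type} [AddCommGroup X] [Module F X] [Fintype X]
    [Module.Finite F X] (hF : ringChar F ≠ 2) {ψ : AddChar F ℂ} (hψ : ψ ≠ 1)
    {B₁ B₂ : LinearMap.BilinForm F X} (hs₁ : B₁.IsSymm) (hs₂ : B₂.IsSymm) (S : X →ₗ[F] X)
    (hS : ∀ x y, B₂ x y = B₁ x (S y)) (hker : LinearMap.ker B₁ = LinearMap.ker B₂)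
    (hfix : ∀ x ∈ LinearMap.ker B₁, S x = x) :
    formGaussSum ψ B₂ = quadChar F (LinearMap.det S) * formGaussSum ψ B₁ := by
  classical
  obtain ⟨C, hC⟩ := Submodule.exists_isCompl (LinearMap.ker B₁)
  set K := LinearMap.ker B₁ with hK
  let e := Submodule.prodEquivOfIsCompl K C hC
  let bK := Module.finBasis F K
  let bC := Module.finBasis F C
  let b := (bK.prod bC).map e
  have hbl : ∀ i, b (Sum.inl i) = (bK i : X) := fun i => by simp [b, e]
  have hbr : ∀ i, b (Sum.inr i) = (bC i : X) := fun i => by simp [b, e]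
  have hk₁ : ∀ k ∈ K, ∀ x, B₁ k x = 0 := fun k hk x => by
    rw [LinearMap.mem_ker.1 hk, LinearMap.zero_apply]
  have hk₁' : ∀ k ∈ K, ∀ x, B₁ x k = 0 := fun k hk x => by rw [hs₁.eq]; exact hk₁ k hk x
  have hk₂ : ∀ k ∈ K, ∀ x, B₂ k x = 0 := fun k hk x => by
    rw [hker] at hk
    rw [LinearMap.mem_ker.1 hk, LinearMap.zero_apply]
  have hk₂' : ∀ k ∈ K, ∀ x, B₂ x k = 0 := fun k hk x => by rw [hs₂.eq]; exact hk₂ k hk x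
  have hsum : ∀ B : LinearMap.BilinForm F X, (∀ k ∈ K, ∀ x, B k x = 0) →
      (∀ k ∈ K, ∀ x, B x k = 0) →
      formGaussSum ψ B = Fintype.card K * formGaussSum ψ (B.restrict C) := by
    intro B h h'
    unfold formGaussSum
    rw [← Equiv.sum_comp e.toEquiv, Fintype.sum_prod_type, ← Finset.card_univ, ← nsmul_eq_mul,
      ← Finset.sum_const]
    refine Finset.sum_congr rfl fun k _ => Finset.sum_congr rfl fun c _ => ?_
    have he : e.toEquiv (k, c) = (k : X) + c := rfl
    rw [he, map_add, map_add, LinearMap.add_apply, LinearMap.add_apply, h _ k.2, h _ k.2,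
      h' _ k.2]
    simp [LinearMap.BilinForm.restrict_apply]
  have hnd : ∀ B : LinearMap.BilinForm F X, B.IsSymm → LinearMap.ker B = K →
      (B.restrict C).Nondegenerate := by
    intro B hs hB
    have key : ∀ c : C, (∀ c' : C, B c c' = 0) → c = 0 := by
      intro c hc
      have : (c : X) ∈ K := by
        rw [← hB, LinearMap.mem_ker]
        ext x
        obtain ⟨⟨k, c'⟩, rfl⟩ := e.surjective x
        have he : e (k, c') = (k : X) + c' := rfl
        have hk : B k = 0 := hB.ge k.2
        rw [he, map_add, hc, hs.eq, hk]
        simp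
      exact Subtype.ext ((Submodule.disjoint_def.1 hC.disjoint) _ this c.2)
    exact ⟨fun c hc => key c hc, fun c hc => key c fun c' =>
      (hs.eq _ _).trans (hc c')⟩
  -- The compression of `S` to `C`. In a basis adapted to `K ⊕ C` the matrix of `S` is block upper
  -- triangular with identity block on `K`, so `det D = det S`.
  let D : Matrix (Fin (Module.finrank F C)) (Fin (Module.finrank F C)) F :=
    (LinearMap.toMatrix b b S).toBlocks₂₂
  have hblocks : LinearMap.toMatrix b b S =
      Matrix.fromBlocks 1 (LinearMap.toMatrix b b S).toBlocks₁₂ 0 D := by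
    have hcol : ∀ i, b.repr (S (b (Sum.inl i))) = Finsupp.single (Sum.inl i) 1 := fun i => by
      rw [hbl, hfix _ (bK i).2, ← hbl, Module.Basis.repr_self]
    conv_lhs => rw [← Matrix.fromBlocks_toBlocks (LinearMap.toMatrix b b S)]
    congr 1
    · ext i j
      simp only [Matrix.toBlocks₁₁, Matrix.of_apply, LinearMap.toMatrix_apply, hcol,
        Matrix.one_apply, Finsupp.single_apply, Sum.inl.injEq, eq_comm]
    · ext i j
      simp [Matrix.toBlocks₂₁, Matrix.of_apply, LinearMap.toMatrix_apply, hcol]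
  have hdet : LinearMap.det S = D.det := by
    rw [← LinearMap.det_toMatrix b, hblocks, Matrix.det_fromBlocks_zero₂₁, Matrix.det_one, one_mul]
  have hmat : LinearMap.BilinForm.toMatrix bC (B₂.restrict C) =
      LinearMap.BilinForm.toMatrix bC (B₁.restrict C) * D := by
    ext i j
    rw [LinearMap.BilinForm.toMatrix_apply, Matrix.mul_apply]
    simp only [LinearMap.BilinForm.toMatrix_apply]
    change B₂ (bC i) (bC j) = ∑ k, B₁ (bC i) (bC k) *
      (LinearMap.toMatrix b b S) (Sum.inr k) (Sum.inr j)
    rw [hS, ← hbr j]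
    conv_lhs => rw [← b.sum_repr (S (b (Sum.inr j)))]
    rw [Fintype.sum_sum_type, map_add, map_sum, map_sum]
    simp only [map_smul, smul_eq_mul, hbl, hk₁' _ (bK _).2, mul_zero, Finset.sum_const_zero,
      zero_add]
    refine Finset.sum_congr rfl fun k _ => ?_
    rw [LinearMap.toMatrix_apply, hbr, hbr, mul_comm]
  have hr : ∀ B : LinearMap.BilinForm F X, B.IsSymm → (B.restrict C).IsSymm := fun B hs =>
    ⟨fun x y => hs.eq x y⟩
  rw [hsum B₁ hk₁ hk₁', hsum B₂ hk₂ hk₂',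
    formGaussSum_eq hF hψ bC _ (hr _ hs₂) (hnd _ hs₂ hker.symm),
    formGaussSum_eq hF hψ bC _ (hr _ hs₁) (hnd _ hs₁ rfl), hmat, Matrix.det_mul, hdet, map_mul]
  ring

end GaussSums

end SympSpace

namespace SympSpace

/-! ### Lagrangians transverse to three given ones. -/

section Transversal

variable {F : Type} [Field F]

/-- A subspace is never the union of two proper subspaces; with at least three scalars it is not the
union of three either. Given `x` outside `A` and `B` but in `C`, and `y` outside `C`, the line `y +
t x` avoids `C` and meets each of `A` and `B` at most once. So one of `t = 0, 1, -1` works. -/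
theorem exists_mem_notMem_three {X : Type} [AddCommGroup X] [Module F X] (h2 : (2 : F) ≠ 0)
    {W A B C : Submodule F X} (hA : ¬ W ≤ A) (hB : ¬ W ≤ B) (hC : ¬ W ≤ C) :
    ∃ x ∈ W, x ∉ A ∧ x ∉ B ∧ x ∉ C := by
  obtain ⟨x, hxW, hxA, hxB⟩ : ∃ x ∈ W, x ∉ A ∧ x ∉ B := by
    obtain ⟨a, haW, haA⟩ := SetLike.not_le_iff_exists.1 hA
    obtain ⟨b, hbW, hbB⟩ := SetLike.not_le_iff_exists.1 hB
    by_cases haB : a ∈ B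
    · by_cases hbA : b ∈ A
      · exact ⟨a + b, W.add_mem haW hbW, fun h => haA ((A.add_mem_iff_left hbA).1 h),
          fun h => hbB ((B.add_mem_iff_right haB).1 h)⟩
      · exact ⟨b, hbW, hbA, hbB⟩
    · exact ⟨a, haW, haA, haB⟩
  by_cases hxC : x ∈ C
  · obtain ⟨y, hyW, hyC⟩ := SetLike.not_le_iff_exists.1 hC
    have key : ∀ D : Submodule F X, x ∉ D → ∀ s t : F, s ≠ t → y + s • x ∈ D →
        y + t • x ∉ D := by
      intro D hD s t hst hs ht
      refine hD ((D.smul_mem_iff (sub_ne_zero.2 hst)).1 ?_)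
      convert D.sub_mem hs ht using 1
      module
    by_contra! hcon
    have hall : ∀ t : F, y + t • x ∉ A → y + t • x ∈ B := by
      intro t h
      by_contra h'
      refine hyC ((C.add_mem_iff_left (C.smul_mem t hxC)).1 ?_)
      exact hcon _ (W.add_mem hyW (W.smul_mem t hxW)) h h'
    have h01 : (0 : F) ≠ 1 := zero_ne_one
    have h02 : (0 : F) ≠ -1 := by simp
    have h12 : (1 : F) ≠ -1 := by
      intro h
      exact h2 (by linear_combination h)
    by_cases h0 : y + (0 : F) • x ∈ A
    · exact key B hxB 1 (-1) h12 (hall _ (key A hxA _ _ h01 h0)) (hall _ (key A hxA _ _ h02 h0))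
    · have hb := hall _ h0
      by_cases h1 : y + (1 : F) • x ∈ A
      · exact key B hxB _ _ h02 hb (hall _ (key A hxA _ _ h12 h1))
      · exact key B hxB _ _ h01 hb (hall _ h1)
  · exact ⟨x, hxW, hxA, hxB, hxC⟩

theorem isRefl (V : SympSpace F) : V.form.IsRefl := V.alt.isRefl

theorem orthogonal_orthogonal (V : SympSpace F) (W : Submodule F V) :
    V.form.orthogonal (V.form.orthogonal W) = W :=
  LinearMap.BilinForm.orthogonal_orthogonal V.nondegenerate V.isRefl W

theorem orthogonal_sup (V : SympSpace F) (A B : Submodule F V) :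
    V.form.orthogonal (A ⊔ B) = V.form.orthogonal A ⊓ V.form.orthogonal B := by
  refine le_antisymm (le_inf (LinearMap.BilinForm.orthogonal_le le_sup_left)
    (LinearMap.BilinForm.orthogonal_le le_sup_right)) ?_
  rintro x ⟨hA, hB⟩ y hy
  obtain ⟨a, ha, b, hb, rfl⟩ := Submodule.mem_sup.1 hy
  change V.form (a + b) x = 0
  rw [map_add, LinearMap.add_apply, hA a ha, hB b hb, add_zero]

/-- A Lagrangian subspace transverse to three given isotropic subspaces. -/
theorem exists_lagrangian_inf_eq_bot [Finite F] (h2 : (2 : F) ≠ 0) (V : SympSpace F)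
    (A : Fin 3 → Submodule F V) (hA : ∀ i, A i ≤ V.form.orthogonal (A i)) :
    ∃ N : Submodule F V, V.form.orthogonal N = N ∧ ∀ i, A i ⊓ N = ⊥ := by
  have : Finite V := Module.finite_of_finite F
  have : Finite (Submodule F V) := Finite.of_injective _ SetLike.coe_injective
  -- A maximal isotropic `N` meeting every `A i` trivially. If it were not Lagrangian, a suitable
  -- vector of its orthogonal could be added.
  obtain ⟨N, hN⟩ := (Set.toFinite {N : Submodule F V | N ≤ V.form.orthogonal N ∧
    ∀ i, A i ⊓ N = ⊥}).exists_maximal ⟨⊥, bot_le, fun i => inf_bot_eq _⟩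
  obtain ⟨⟨hiso, hdisj⟩, hmax⟩ := hN
  refine ⟨N, le_antisymm ?_ hiso, hdisj⟩
  by_contra hnot
  -- If `N^⊥ ≤ N + A i`, taking orthogonals gives `N^⊥ ∩ (A i)^⊥ ≤ N`. The `A i`-component of a
  -- vector of `N^⊥` then lies in `A i ∩ N = 0`, which forces `N^⊥ ≤ N`.
  have hcover : ∀ i, ¬ V.form.orthogonal N ≤ N ⊔ A i := by
    intro i h
    apply hnot
    have h1 : V.form.orthogonal (N ⊔ A i) ≤ N := by
      refine (LinearMap.BilinForm.orthogonal_le h).trans ?_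
      rw [orthogonal_orthogonal]
    rw [orthogonal_sup] at h1
    intro x hx
    obtain ⟨n, hn, a, ha, rfl⟩ := Submodule.mem_sup.1 (h hx)
    have ha' : a ∈ V.form.orthogonal N := by
      have := Submodule.sub_mem _ hx (hiso hn)
      rwa [add_sub_cancel_left] at this
    have ha0 : a ∈ A i ⊓ N := ⟨ha, h1 ⟨ha', hA i ha⟩⟩
    rw [hdisj] at ha0
    rw [(Submodule.mem_bot F).1 ha0, add_zero]
    exact hn
  obtain ⟨x, hx, h0, h1, h3⟩ := exists_mem_notMem_three h2 (hcover 0) (hcover 1) (hcover 2)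
  have hxA : ∀ i, x ∉ N ⊔ A i := by
    intro i
    fin_cases i
    exacts [h0, h1, h3]
  -- Adding `x ∈ N^⊥` keeps `N` isotropic, and `x ∉ N + A i` keeps the intersection with `A i`
  -- trivial.
  have hN' : N ⊔ F ∙ x ∈ {N : Submodule F V | N ≤ V.form.orthogonal N ∧ ∀ i, A i ⊓ N = ⊥} := by
    constructor
    · rw [orthogonal_sup]
      have hxx : F ∙ x ≤ V.form.orthogonal (F ∙ x) := by
        rw [Submodule.span_singleton_le_iff_mem]
        intro y hy
        obtain ⟨c, rfl⟩ := Submodule.mem_span_singleton.1 hy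
        change V.form (c • x) x = 0
        rw [map_smul, LinearMap.smul_apply, V.alt.self_eq_zero, smul_zero]
      refine sup_le (le_inf hiso ?_) (le_inf ?_ hxx)
      · intro n hn y hy
        obtain ⟨c, rfl⟩ := Submodule.mem_span_singleton.1 hy
        change V.form (c • x) n = 0
        rw [map_smul, LinearMap.smul_apply, V.isRefl _ _ (hx n hn), smul_zero]
      · rwa [Submodule.span_singleton_le_iff_mem]
    · intro i
      rw [eq_bot_iff]
      rintro y ⟨hyA, hyN⟩
      obtain ⟨n, hn, z, hz, rfl⟩ := Submodule.mem_sup.1 hyN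
      obtain ⟨c, rfl⟩ := Submodule.mem_span_singleton.1 hz
      have hc : c = 0 := by
        by_contra hc
        apply hxA i
        rw [← (N ⊔ A i).smul_mem_iff hc]
        have := Submodule.sub_mem _ (Submodule.mem_sup_right (S := N) hyA)
          (Submodule.mem_sup_left (T := A i) hn)
        rwa [add_sub_cancel_left] at this
      subst hc
      rw [zero_smul, add_zero] at hyA ⊢
      exact (hdisj i).le ⟨hyA, hn⟩
  have := hmax hN' le_sup_left
  exact h0 (Submodule.mem_sup_left (this (Submodule.mem_sup_right
    (Submodule.mem_span_singleton_self x))))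

end Transversal

/-! ### Orientation vectors in bases, and the normalizing constant as a determinant. -/

section Orientation

variable {F : Type} [Field F] {X : Type} [AddCommGroup X] [Module F X]

/-- The functional on the top exterior power induced by `b.det` takes the value `1` there. -/
theorem ιMulti_basis_ne_zero {n : ℕ} (b : Module.Basis (Fin n) F X) :
    exteriorPower.ιMulti F n b ≠ 0 := by
  intro h
  have h1 := exteriorPower.alternatingMapLinearEquiv_apply_ιMulti b.det b
  rw [h, map_zero, b.det_self] at h1
  exact zero_ne_one h1

theorem ιMulti_ne_zero {n : ℕ} {v : Fin n → X} (hv : LinearIndependent F v) :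
    ExteriorAlgebra.ιMulti F n v ≠ 0 := by
  have h0 := ιMulti_basis_ne_zero (Module.Basis.span hv)
  have hinj := exteriorPower.map_injective_field (n := n)
    (f := (Submodule.span F (Set.range v)).subtype) (Submodule.subtype_injective _)
  have h1 := (map_ne_zero_iff _ hinj).2 h0
  rw [exteriorPower.map_apply_ιMulti] at h1
  intro h
  apply h1
  refine Subtype.ext (Eq.trans ?_ h)
  rw [exteriorPower.ιMulti_apply_coe]
  congr 1
  funext i
  simp [Module.Basis.span_apply]

namespace OrientedLagrangian

variable {V : SympSpace F}

/-- Any Lagrangian subspace carries an orientation. -/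
theorem exists_space_eq {N : Submodule F V} (hN : V.form.orthogonal N = N) :
    ∃ L : OrientedLagrangian V, L.space = N := by
  let b := Module.finBasis F N
  refine ⟨⟨N, hN, ExteriorAlgebra.ιMulti F _ (fun i => (b i : V)), ?_, ?_⟩, rfl⟩
  · refine ⟨ExteriorAlgebra.ιMulti F _ b, (exteriorPower.ιMulti F _ b).2, ?_⟩
    exact ExteriorAlgebra.map_apply_ιMulti _ _
  · exact ιMulti_ne_zero (b.linearIndependent.map' _ (Submodule.ker_subtype N))

/-- A basis of an oriented Lagrangian, indexed by `Fin (halfDim V)`. -/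
noncomputable def basis (L : OrientedLagrangian V) :
    Module.Basis (Fin (halfDim V)) F L.space :=
  Module.finBasisOfFinrankEq F L.space L.finrank_space

theorem exists_vec_eq (L : OrientedLagrangian V) {n : ℕ} (l : Module.Basis (Fin n) F L.space) :
    ∃ a : F, a ≠ 0 ∧ L.vec = a • ExteriorAlgebra.ιMulti F n (fun i => (l i : V)) := by
  obtain ⟨x, hx, h⟩ := L.vec_mem
  have hn : Module.finrank F L.space = n := by
    rw [Module.finrank_eq_card_basis l, Fintype.card_fin]
  rw [hn] at hx
  have h1 : Module.finrank F (⋀[F]^n L.space) = 1 := by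
    rw [exteriorPower.finrank_eq, hn, Nat.choose_self]
  obtain ⟨a, ha⟩ := (finrank_eq_one_iff_of_nonzero' _ (ιMulti_basis_ne_zero l)).1 h1 ⟨x, hx⟩
  have h2 : L.vec = a • ExteriorAlgebra.ιMulti F n (fun i => (l i : V)) := by
    have hx' : x = a • ExteriorAlgebra.ιMulti F n l := (congrArg Subtype.val ha).symm
    rw [← h, hx']
    change ExteriorAlgebra.map _ (a • ExteriorAlgebra.ιMulti F n l) = _
    rw [map_smul, ExteriorAlgebra.map_apply_ιMulti]
    rfl
  refine ⟨a, ?_, h2⟩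
  rintro rfl
  exact L.vec_ne_zero (by rw [h2, zero_smul])

theorem exists_transverse [Finite F] (h2 : (2 : F) ≠ 0) (A B C : OrientedLagrangian V) :
    ∃ N : OrientedLagrangian V, A.space ⊓ N.space = ⊥ ∧ B.space ⊓ N.space = ⊥ ∧
      C.space ⊓ N.space = ⊥ := by
  obtain ⟨N, hN, h⟩ := exists_lagrangian_inf_eq_bot h2 V ![A.space, B.space, C.space] (by
    intro i
    fin_cases i
    exacts [A.lagrangian.ge, B.lagrangian.ge, C.lagrangian.ge])
  obtain ⟨N, rfl⟩ := exists_space_eq hN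
  exact ⟨N, h 0, h 1, h 2⟩

theorem nonempty [Finite F] (h2 : (2 : F) ≠ 0) (V : SympSpace F) :
    Nonempty (OrientedLagrangian V) := by
  obtain ⟨N, hN, -⟩ := exists_lagrangian_inf_eq_bot h2 V (fun _ => ⊥) (fun _ => bot_le)
  obtain ⟨N, -⟩ := exists_space_eq hN
  exact ⟨N⟩

/-- `(L + M)^⊥ = L ∩ M = 0`, hence `L + M` is everything. -/
theorem isCompl {L M : OrientedLagrangian V} (h : L.space ⊓ M.space = ⊥) :
    IsCompl L.space M.space := by
  refine ⟨disjoint_iff.2 h, codisjoint_iff.2 ?_⟩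
  rw [← V.orthogonal_orthogonal (L.space ⊔ M.space), orthogonal_sup, L.lagrangian, M.lagrangian, h]
  exact LinearMap.BilinForm.orthogonal_bot

/-- A left null vector of the matrix gives a nonzero element of `L` orthogonal to `M`, hence in `M^⊥
= M`. -/
theorem det_form_ne_zero {L M : OrientedLagrangian V} (h : L.space ⊓ M.space = ⊥) {n : ℕ}
    (l : Module.Basis (Fin n) F L.space) (m : Module.Basis (Fin n) F M.space) :
    (Matrix.of fun i j => V.form (l i) (m j)).det ≠ 0 := by
  intro hdet
  obtain ⟨v, hv, hv0⟩ := Matrix.exists_vecMul_eq_zero_iff.2 hdet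
  have hx : ∀ y ∈ M.space, V.form (l.equivFun.symm v : L.space) y = 0 := by
    intro y hy
    obtain ⟨w, hw⟩ := m.equivFun.symm.surjective ⟨y, hy⟩
    have hy' : y = (m.equivFun.symm w : M.space) := (congrArg Subtype.val hw).symm
    rw [hy']
    simp only [Module.Basis.equivFun_symm_apply, AddSubmonoidClass.coe_finsetSum,
      Submodule.coe_smul, map_sum, map_smul]
    refine Finset.sum_eq_zero fun j _ => ?_
    have := congrFun hv0 j
    simp only [Matrix.vecMul, dotProduct, Matrix.of_apply, Pi.zero_apply] at this
    rw [LinearMap.sum_apply]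
    simp only [LinearMap.smul_apply, smul_eq_mul]
    rw [this, mul_zero]
  have hxM : ((l.equivFun.symm v : L.space) : V) ∈ M.space := by
    rw [← M.lagrangian]
    exact fun y hy => V.isRefl _ _ (hx y hy)
  have h0 := h.le ⟨(l.equivFun.symm v).2, hxM⟩
  apply hv
  rw [← l.equivFun.symm.map_eq_zero_iff]
  exact Subtype.ext ((Submodule.mem_bot F).1 h0)

end OrientedLagrangian

variable [Fintype F] [DecidableEq F]

/-- The sign `(-1)^(n choose 2)` in the constant cancels the one in `wedgePairing`, leaving the
plain Gram determinant. -/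
theorem normConst_eq (ψ : AddChar F ℂ) {V : SympSpace F} (M L : OrientedLagrangian V) {a b : F}
    {l m : Fin (halfDim V) → V} (hL : L.vec = a • ExteriorAlgebra.ιMulti F _ l)
    (hM : M.vec = b • ExteriorAlgebra.ιMulti F _ m) :
    normConst ψ M L = (gaussSum₁ ψ / Fintype.card F) ^ halfDim V *
      quadChar F (a * b * (Matrix.of fun i j => V.form (l i) (m j)).det) := by
  have hL' : L.vec' = a • exteriorPower.ιMulti F _ l := Subtype.ext hL
  have hM' : M.vec' = b • exteriorPower.ιMulti F _ m := Subtype.ext hM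
  have h : wedgePairing V (halfDim V) L.vec' M.vec' = a * b *
      wedgePairing V (halfDim V) (exteriorPower.ιMulti F _ l) (exteriorPower.ιMulti F _ m) := by
    rw [hL', hM']
    unfold wedgePairing
    simp only [map_smul, LinearMap.smul_apply, smul_eq_mul]
    ring
  unfold normConst
  rw [h, wedgePairing_ιMulti, MulChar.ringHomComp_apply]
  have h1 : ((-1 : F) ^ (halfDim V).choose 2) * (-1) ^ (halfDim V).choose 2 = 1 := by
    rw [← mul_pow]; simp
  have h2 : (-1 : F) ^ (halfDim V).choose 2 * (a * b * ((-1) ^ (halfDim V).choose 2 *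
      (Matrix.of fun i j => V.form (l i) (m j)).det)) =
        a * b * (Matrix.of fun i j => V.form (l i) (m j)).det := by
    linear_combination (a * b * (Matrix.of fun i j => V.form (l i) (m j)).det) * h1
  rw [h2]
  rfl

end Orientation

end SympSpace

/-! ### The symmetric form attached to two Lagrangians and a common complement. -/

namespace SympSpace

open Heisenberg

/-- The nonempty fibres of `r` are cosets of its kernel, and the support condition discards the
others. -/
theorem sum_comp_linearMap {F X Y : Type} [Field F] [AddCommGroup X] [Module F X]
    [AddCommGroup Y] [Module F Y] [Fintype X] [Fintype Y] (r : X →ₗ[F] Y) (g : Y → ℂ)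
    (hg : ∀ y, g y ≠ 0 → y ∈ LinearMap.range r) :
    ∑ x, g (r x) = Nat.card (LinearMap.ker r) * ∑ y, g y := by
  classical
  rw [← Finset.sum_fiberwise (Finset.univ : Finset X) (fun x => r x), Finset.mul_sum]
  refine Finset.sum_congr rfl fun y _ => ?_
  rw [Finset.sum_congr rfl (g := fun _ => g y) fun x hx => by rw [(Finset.mem_filter.1 hx).2],
    Finset.sum_const, nsmul_eq_mul]
  by_cases h : g y = 0
  · rw [h, mul_zero, mul_zero]
  obtain ⟨x₀, rfl⟩ := hg y h
  congr 2
  rw [← Fintype.card_subtype, ← Nat.card_eq_fintype_card]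
  exact Nat.card_congr
    { toFun := fun x => ⟨x.1 - x₀, by rw [LinearMap.mem_ker, map_sub, x.2, sub_self]⟩
      invFun := fun x => ⟨x.1 + x₀, by rw [map_add, LinearMap.mem_ker.1 x.2, zero_add]⟩
      left_inv := fun x => by simp
      right_inv := fun x => by simp }

namespace OrientedLagrangian

variable {F : Type} [Field F] {V : SympSpace F}

noncomputable instance [Fintype F] (L : OrientedLagrangian V) : Fintype L.space :=
  have : Finite V := Module.finite_of_finite F
  Fintype.ofFinite _

/-- Two common complements of a Lagrangian are identified along it. -/
theorem exists_equiv_sub_mem {L M N : OrientedLagrangian V} (hL : L.space ⊓ N.space = ⊥)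
    (hM : M.space ⊓ N.space = ⊥) :
    ∃ φ : L.space ≃ₗ[F] M.space, ∀ l : L.space, (φ l : V) - l ∈ N.space := by
  let eL := Submodule.quotientEquivOfIsCompl _ _ (isCompl hL).symm
  let eM := Submodule.quotientEquivOfIsCompl _ _ (isCompl hM).symm
  refine ⟨eL.symm.trans eM, fun l => ?_⟩
  rw [← Submodule.Quotient.eq]
  refine (Submodule.mk_quotientEquivOfIsCompl_apply (isCompl hM).symm (eL.symm l)).trans ?_
  rw [← Submodule.mk_quotientEquivOfIsCompl_apply (isCompl hL).symm (eL.symm l)]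
  exact congrArg (fun x : L.space => (Submodule.Quotient.mk (x : V) : V ⧸ N.space))
    (eL.apply_symm_apply l)

/-- The form `ω(l, φ l')` on a Lagrangian `L` defined by a map `φ` to another Lagrangian. -/
def twistedForm {L M : OrientedLagrangian V} (φ : L.space →ₗ[F] M.space) :
    LinearMap.BilinForm F L.space :=
  V.form.compl₁₂ L.space.subtype (M.space.subtype ∘ₗ φ)

theorem twistedForm_apply {L M : OrientedLagrangian V} (φ : L.space →ₗ[F] M.space)
    (l l' : L.space) : twistedForm φ l l' = V.form l (φ l') := rfl

variable {L M N : OrientedLagrangian V} (φ : L.space ≃ₗ[F] M.space)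
  (hφ : ∀ l : L.space, (φ l : V) - l ∈ N.space)

include hφ

/-- Expand `ω(φ x - x, φ y - y) = 0`. Two of the four terms vanish since `L` and `M` are isotropic,
leaving `ω(x, φ y) = -ω(φ x, y) = ω(y, φ x)`. -/
theorem twistedForm_isSymm : (twistedForm φ.toLinearMap).IsSymm := by
  refine ⟨fun x y => ?_⟩
  simp only [twistedForm_apply, LinearEquiv.coe_coe]
  have h1 := N.form_eq_zero (hφ x) (hφ y)
  have h2 := L.form_eq_zero x.2 y.2
  have h3 := M.form_eq_zero (φ x).2 (φ y).2
  have h4 := V.alt.neg_eq (y : V) (φ x)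
  simp only [map_sub, LinearMap.sub_apply] at h1
  linear_combination h3 + h2 - h1 + h4

theorem apply_eq_self_iff (hM : M.space ⊓ N.space = ⊥) (l : L.space) :
    (φ l : V) = l ↔ (l : V) ∈ M.space := by
  constructor
  · intro h
    rw [← h]
    exact (φ l).2
  · intro h
    have := hM.le ⟨M.space.sub_mem (φ l).2 h, hφ l⟩
    exact sub_eq_zero.1 ((Submodule.mem_bot F).1 this)

/-- By symmetry, `l` in the kernel means `φ l ∈ L^⊥ = L`. Then `φ l - l ∈ L ∩ N = 0`, so `l = φ l ∈
M`. -/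
theorem ker_twistedForm (hL : L.space ⊓ N.space = ⊥) :
    LinearMap.ker (twistedForm φ.toLinearMap) = M.space.comap L.space.subtype := by
  ext l
  rw [LinearMap.mem_ker, Submodule.mem_comap, Submodule.subtype_apply]
  constructor
  · intro h
    have h1 : (φ l : V) ∈ L.space := by
      refine L.lagrangian.le fun x hx => ?_
      have := LinearMap.congr_fun h ⟨x, hx⟩
      rw [(twistedForm_isSymm φ hφ).eq] at this
      exact this
    have := hL.le ⟨L.space.sub_mem h1 l.2, hφ l⟩
    rw [← sub_eq_zero.1 ((Submodule.mem_bot F).1 this)]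
    exact (φ l).2
  · intro h
    ext l'
    exact M.form_eq_zero h (φ l').2

/-- The map `l ↦ φ l - l` from `L` to `N`. -/
def subMap : L.space →ₗ[F] N.space :=
  LinearMap.codRestrict N.space (M.space.subtype ∘ₗ φ.toLinearMap - L.space.subtype) hφ

theorem coe_subMap (l : L.space) : (subMap φ hφ l : V) = φ l - l := rfl

theorem ker_subMap (hM : M.space ⊓ N.space = ⊥) :
    LinearMap.ker (subMap φ hφ) = M.space.comap L.space.subtype := by
  ext l
  rw [LinearMap.mem_ker, Submodule.mem_comap, Submodule.subtype_apply,
    ← apply_eq_self_iff φ hφ hM, ← sub_eq_zero (a := (φ l : V)), ← coe_subMap φ hφ,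
    Submodule.coe_eq_zero]

/-- Here `n ∈ (L ∩ M)^⊥ = L + M`. Writing `n = l + φ l'`, the vector `l + l'` lies in `L ∩ N = 0`,
so `n = φ l' - l'`. -/
theorem mem_range_subMap (hL : L.space ⊓ N.space = ⊥) (n : N.space)
    (hn : ∀ k ∈ L.space ⊓ M.space, V.form k n = 0) : n ∈ LinearMap.range (subMap φ hφ) := by
  have h : (n : V) ∈ L.space ⊔ M.space := by
    rw [← V.orthogonal_orthogonal (L.space ⊔ M.space), orthogonal_sup, L.lagrangian,
      M.lagrangian]
    exact hn
  obtain ⟨l, hl, m, hm, hlm⟩ := Submodule.mem_sup.1 h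
  obtain ⟨l', hl'⟩ := φ.surjective ⟨m, hm⟩
  have hm' : m = φ l' := (congrArg Subtype.val hl').symm
  have h0 : l + (l' : V) ∈ L.space ⊓ N.space := by
    refine ⟨L.space.add_mem hl l'.2, ?_⟩
    have := N.space.sub_mem n.2 (hφ l')
    rw [← hlm, hm'] at this
    have e : l + (φ l' : V) - (φ l' - l') = l + l' := by abel
    rwa [e] at this
  rw [hL] at h0
  refine ⟨l', Subtype.ext ?_⟩
  rw [coe_subMap, ← hlm, hm', eq_neg_of_add_eq_zero_left ((Submodule.mem_bot F).1 h0)]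
  abel

end OrientedLagrangian

open OrientedLagrangian

/-! ### Composition of averaging morphisms. -/

section Averaging

variable {F : Type} [Field F] [Fintype F] {V : SympSpace F} {ψ : AddChar F ℂ}

theorem averaging_apply (M L : OrientedLagrangian V) (f : model ψ L.space) (h : Heisenberg V) :
    (averaging ψ M L f).1 h = ∑ m : M.space, f.1 (ofVec m.1 * h) :=
  finsum_eq_sum_of_fintype _

theorem averaging_self (L : OrientedLagrangian V) (f : model ψ L.space) :
    averaging ψ L L f = (Fintype.card L.space : ℂ) • f := by
  refine Subtype.ext (funext fun h => ?_)
  rw [averaging_apply, Finset.sum_congr rfl fun l _ => f.2.2 l.1 l.2 h]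
  simp

variable {L M N : OrientedLagrangian V}

/-- The composition of two averaging morphisms through a common complement. -/
theorem averaging_comp_averaging (h2 : (2 : F) ≠ 0) (hψ : ψ ≠ 1)
    (hL : L.space ⊓ N.space = ⊥) (hM : M.space ⊓ N.space = ⊥)
    (φ : L.space ≃ₗ[F] M.space) (hφ : ∀ l : L.space, (φ l : V) - l ∈ N.space) :
    (Nat.card (M.space.comap L.space.subtype) : ℂ) • (averaging ψ M N ∘ₗ averaging ψ N L) =
      formGaussSum ψ (twistedForm φ.toLinearMap) • averaging ψ M L := by
  set B := twistedForm φ.toLinearMap with hB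
  have hBs : B.IsSymm := twistedForm_isSymm φ hφ
  have hBr : ∀ l l', B l l' = V.form l (subMap φ hφ l') := fun l l' => by
    rw [coe_subMap, map_sub, L.form_eq_zero l.2 l'.2, sub_zero]
    rfl
  have half : (2 : F)⁻¹ + 2⁻¹ = 1 := by rw [← two_mul, mul_inv_cancel₀ h2]
  -- The composite sends `f` to `h ↦ ∑ n, K n * f (n h)`: write `m = φ l`, translate `n` by `φ l -
  -- l`, and absorb `l` by the `L`-invariance of `f`.
  let K : N.space → ℂ := fun n => ∑ l : L.space, ψ (2⁻¹ * B l l - V.form l n)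
  -- Completing the square: replace the summation variable `l` by `l + l''`.
  have hK : ∀ l, K (subMap φ hφ l) = formGaussSum ψ B * ψ (-(2⁻¹ * B l l)) := by
    intro l''
    simp only [K, formGaussSum, Finset.sum_mul]
    refine (Equiv.sum_comp (Equiv.addRight l'') _).symm.trans (Finset.sum_congr rfl fun l _ => ?_)
    rw [← AddChar.map_add_eq_mul, ← hBr, Equiv.coe_addRight]
    congr 1
    simp only [map_add, LinearMap.add_apply]
    rw [hBs.eq l'' l]
    linear_combination (B l l'' + B l'' l'') * half
  -- If `n` is not orthogonal to some `k ∈ L ∩ M`, translating the summation variable by a multiple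
  -- of `k`, which lies in the kernel of `B`, multiplies `K n` by a character value other than `1`.
  have hK0 : ∀ n, K n ≠ 0 → n ∈ LinearMap.range (subMap φ hφ) := by
    intro n hn
    refine mem_range_subMap φ hφ hL n fun k hk => ?_
    by_contra hkn
    have hp : ψ.mulShift (V.form k n) ≠ 1 := AddChar.IsPrimitive.of_ne_one hψ hkn
    obtain ⟨c, hc⟩ := AddChar.ne_one_iff.1 hp
    have hkL : -c • k ∈ L.space := L.space.smul_mem _ hk.1
    have hker : B ⟨-c • k, hkL⟩ = 0 := by
      rw [← LinearMap.mem_ker, ker_twistedForm φ hφ hL]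
      exact M.space.smul_mem _ hk.2
    have key : K n = ψ (V.form k n * c) * K n := by
      conv_lhs => rw [show K n = ∑ l : L.space, ψ (2⁻¹ * B l l - V.form l n) from rfl,
        ← Equiv.sum_comp (Equiv.addRight (⟨-c • k, hkL⟩ : L.space))]
      simp only [K, Finset.mul_sum]
      refine Finset.sum_congr rfl fun l _ => ?_
      rw [← AddChar.map_add_eq_mul, Equiv.coe_addRight]
      congr 1
      simp only [map_add, LinearMap.add_apply, hker, Submodule.coe_add, LinearMap.zero_apply]
      rw [hBs.eq l ⟨_, hkL⟩, hker]
      simp only [LinearMap.zero_apply, map_smul, LinearMap.smul_apply, smul_eq_mul]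
      ring
    have h1 : ψ (V.form k n * c) = 1 := by
      have := mul_right_cancel₀ hn ((one_mul _).trans key)
      exact this.symm
    exact hc h1
  refine LinearMap.ext fun f => Subtype.ext (funext fun h => ?_)
  change (Nat.card (M.space.comap L.space.subtype) : ℂ) *
    (averaging ψ M N (averaging ψ N L f)).1 h = formGaussSum ψ B * (averaging ψ M L f).1 h
  rw [averaging_apply, averaging_apply, ← Equiv.sum_comp φ.toEquiv, ← Equiv.sum_comp φ.toEquiv,
    Finset.mul_sum (s := Finset.univ) (a := formGaussSum ψ B)]
  have hleft : ∀ l : L.space, (averaging ψ N L f).1 (ofVec (φ.toEquiv l).1 * h) =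
      ∑ n : N.space, ψ (2⁻¹ * B l l - V.form l n) * f.1 (ofVec n.1 * h) := by
    intro l
    rw [averaging_apply, ← Equiv.sum_comp (Equiv.subRight (subMap φ hφ l))]
    refine Finset.sum_congr rfl fun n _ => ?_
    have e1 : (φ l : V) = l + subMap φ hφ l := by rw [coe_subMap]; abel
    have e2 := N.form_eq_zero n.2 (subMap φ hφ l).2
    have e3 := V.alt.self_eq_zero (subMap φ hφ l : V)
    have e4 := V.alt.neg_eq (l : V) n
    have e5 := V.alt.neg_eq (l : V) (subMap φ hφ l)
    have e : ofVec (n - subMap φ hφ l : V) * ofVec (φ l : V) =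
        ofCen (2⁻¹ * B l l - V.form l n) * (ofVec (l : V) * ofVec (n : V)) := by
      refine Heisenberg.ext ?_ ?_
      · simp only [mul_vec, ofVec_vec, ofCen_vec, zero_add]
        rw [e1]
        abel
      · simp only [mul_vec, mul_cen, ofVec_vec, ofVec_cen, ofCen_vec, ofCen_cen, zero_add]
        rw [e1, hBr]
        simp only [map_add, map_sub, LinearMap.sub_apply, map_zero, LinearMap.zero_apply]
        rw [e2, e3, ← e4, ← e5]
        linear_combination -(V.form l n) * half
    change f.1 (ofVec (n - subMap φ hφ l : V) * (ofVec (φ l : V) * h)) = _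
    rw [← mul_assoc, e, mul_assoc, f.2.1, mul_assoc, f.2.2 l.1 l.2]
  -- Since `φ l` is `l` times `φ l - l` up to a central factor, averaging over `M` sums the same
  -- function of `n`, pulled back along `l ↦ φ l - l`. Each `n` in the range is counted `|L ∩ M|`
  -- times.
  have hright : ∀ l : L.space, formGaussSum ψ B * f.1 (ofVec (φ.toEquiv l).1 * h) =
      K (subMap φ hφ l) * f.1 (ofVec (subMap φ hφ l : V) * h) := by
    intro l
    have e : ofVec (φ l : V) =
        ofCen (-(2⁻¹ * B l l)) * (ofVec (l : V) * ofVec (subMap φ hφ l : V)) := by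
      refine Heisenberg.ext ?_ ?_
      · simp only [mul_vec, ofVec_vec, ofCen_vec, zero_add]
        rw [coe_subMap]
        abel
      · simp only [mul_vec, mul_cen, ofVec_vec, ofVec_cen, ofCen_vec, ofCen_cen, zero_add]
        rw [hBr]
        simp
    change _ * f.1 (ofVec (φ l : V) * h) = _
    rw [hK, e, mul_assoc, f.2.1, mul_assoc, f.2.2 l.1 l.2, mul_assoc]
  rw [Finset.sum_congr rfl fun l _ => hleft l, Finset.sum_congr rfl fun l _ => hright l,
    Finset.sum_comm, sum_comp_linearMap (subMap φ hφ) (fun n => K n * f.1 (ofVec n.1 * h)),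
    ker_subMap φ hφ hM]
  · simp only [K, Finset.sum_mul]
  · intro n hn
    exact hK0 n (left_ne_zero_of_mul hn)

end Averaging

end SympSpace

/-! ### Existence and uniqueness of the canonical system. -/

namespace SympSpace

open Heisenberg OrientedLagrangian

/-- An `n`-linear alternating map on an `n`-dimensional space is `b.det` times its value on `b`.
This measures the change of orientation coordinates under `S`. -/
theorem alternatingMap_comp_basis {F X Y : Type} [Field F] [AddCommGroup X] [Module F X]
    [AddCommGroup Y] [Module F Y] {n : ℕ} (G : X [⋀^Fin n]→ₗ[F] Y)
    (b : Module.Basis (Fin n) F X) (S : X →ₗ[F] X) :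
    G (fun i => S (b i)) = LinearMap.det S • G b := by
  have h : G = (LinearMap.toSpanSingleton F Y (G b)).compAlternatingMap b.det := by
    refine b.ext_alternating fun v hv => ?_
    let σ : Equiv.Perm (Fin n) := Equiv.ofBijective v (Finite.injective_iff_bijective.1 hv)
    change G (b ∘ σ) = b.det (b ∘ σ) • G b
    rw [G.map_perm, b.det.map_perm, b.det_self]
    simp only [Units.smul_def]
    rw [smul_assoc, one_smul]
  conv_lhs => rw [h]
  have h1 := b.det_comp S b
  rw [b.det_self, mul_one] at h1
  change b.det (S ∘ b) • G b = _
  rw [h1]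

theorem card_field_ne_zero (F : Type) [Fintype F] [Nonempty F] : (Fintype.card F : ℂ) ≠ 0 := by
  exact_mod_cast Fintype.card_ne_zero

theorem exists_vec_eq_map {F : Type} [Field F] {V : SympSpace F} {L M : OrientedLagrangian V}
    (φ : L.space ≃ₗ[F] M.space) :
    ∃ μ : F, μ ≠ 0 ∧
    M.vec = μ • ExteriorAlgebra.ιMulti F (halfDim V) (fun i => (φ (L.basis i) : V)) := by
  obtain ⟨μ, h0, h⟩ := M.exists_vec_eq (L.basis.map φ)
  exact ⟨μ, h0, h⟩

section CanonicalSystem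

variable {F : Type} [Field F] [Fintype F] {ψ : AddChar F ℂ} {V : SympSpace F}

theorem averaging_intertwining (M L : OrientedLagrangian V) (h : Heisenberg V) :
    averaging ψ M L ∘ₗ modelRep ψ L.space h = modelRep ψ M.space h ∘ₗ averaging ψ M L := by
  refine LinearMap.ext fun f => Subtype.ext (funext fun k => ?_)
  change ∑ᶠ m : M.space, f.1 (ofVec m.1 * k * h) = ∑ᶠ m : M.space, f.1 (ofVec m.1 * (k * h))
  simp_rw [mul_assoc]

theorem natCard_ne_zero (L M : OrientedLagrangian V) :
    (Nat.card (M.space.comap L.space.subtype) : ℂ) ≠ 0 := by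
  exact_mod_cast Nat.card_pos.ne'

variable [DecidableEq F]

variable (ψ) in
/-- The normalized averaging morphism. -/
noncomputable def normAveraging (M L : OrientedLagrangian V) :
    model ψ L.space →ₗ[ℂ] model ψ M.space :=
  normConst ψ M L • averaging ψ M L

variable {L M N N' : OrientedLagrangian V}

/-- Since `ω(n, φ l) = ω(n, l)`, using the basis `φ(lᵢ)` of `M` makes the two Gram matrices with `N`
agree up to transposition and sign. The determinant therefore enters squared, and the remaining
`σ(-1)^n` cancels the one from `G₁^(2n) = σ(-1)^n q^n`. -/
theorem normConst_mul_normConst (hF : ringChar F ≠ 2) (hψ : ψ ≠ 1)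
    (hL : L.space ⊓ N.space = ⊥) (φ : L.space ≃ₗ[F] M.space)
    (hφ : ∀ l : L.space, (φ l : V) - l ∈ N.space) {a μ : F}
    (ha : L.vec = a • ExteriorAlgebra.ιMulti F (halfDim V) (fun i => (L.basis i : V)))
    (hμ : M.vec = μ • ExteriorAlgebra.ιMulti F (halfDim V) (fun i => (φ (L.basis i) : V))) :
    normConst ψ M N * normConst ψ N L =
      quadChar F (a * μ) * ((Fintype.card F : ℂ) ^ halfDim V)⁻¹ := by
  obtain ⟨c, hc0, hc⟩ := N.exists_vec_eq N.basis
  rw [normConst_eq ψ M N hc hμ, normConst_eq ψ N L ha hc]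
  have hdet := det_form_ne_zero hL L.basis N.basis
  set D := (Matrix.of fun i j => V.form (L.basis i) (N.basis j)).det with hD
  have hD' : (Matrix.of fun i j => V.form (N.basis i) (φ (L.basis j))).det =
      (-1) ^ halfDim V * D := by
    have : (Matrix.of fun i j => V.form (N.basis i) (φ (L.basis j))) =
        -(Matrix.of fun i j => V.form (L.basis i) (N.basis j)).transpose := by
      ext i j
      have h1 := N.form_eq_zero (N.basis i).2 (hφ (L.basis j))
      rw [map_sub, sub_eq_zero] at h1
      simp only [Matrix.of_apply, Matrix.neg_apply, Matrix.transpose_apply]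
      rw [h1, V.alt.neg_eq]
    rw [this, Matrix.det_neg, Matrix.det_transpose, Fintype.card_fin]
  rw [hD']
  have hG := gaussSum₁_sq hF hψ
  have hq := card_field_ne_zero F
  have h1 : quadChar F (-1) * quadChar F (-1) = 1 := quadChar_mul_self (by simp)
  have hcc := quadChar_mul_self hc0
  have hDD := quadChar_mul_self hdet
  have hGG : (gaussSum₁ ψ / Fintype.card F) ^ halfDim V * (gaussSum₁ ψ / Fintype.card F) ^ halfDim V
      = quadChar F (-1) ^ halfDim V * ((Fintype.card F : ℂ) ^ halfDim V)⁻¹ := by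
    rw [← mul_pow, div_mul_div_comm, ← sq, hG, mul_div_mul_right _ _ hq, div_pow, div_eq_mul_inv]
  have h1n : quadChar F (-1) ^ halfDim V * quadChar F (-1) ^ halfDim V = 1 := by
    rw [← mul_pow, h1, one_pow]
  simp only [map_mul, map_pow]
  calc _ = ((gaussSum₁ ψ / Fintype.card F) ^ halfDim V *
        (gaussSum₁ ψ / Fintype.card F) ^ halfDim V) * (quadChar F c * quadChar F c) *
        (quadChar F D * quadChar F D) * quadChar F (-1) ^ halfDim V *
          (quadChar F a * quadChar F μ) := by ring
    _ = _ := by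
      rw [hGG, hcc, hDD]
      linear_combination (quadChar F a * quadChar F μ * ((Fintype.card F : ℂ) ^ halfDim V)⁻¹) * h1n

theorem normAveraging_comp (hF : ringChar F ≠ 2) (hψ : ψ ≠ 1)
    (hL : L.space ⊓ N.space = ⊥) (hM : M.space ⊓ N.space = ⊥) (φ : L.space ≃ₗ[F] M.space)
    (hφ : ∀ l : L.space, (φ l : V) - l ∈ N.space) {a μ : F}
    (ha : L.vec = a • ExteriorAlgebra.ιMulti F (halfDim V) (fun i => (L.basis i : V)))
    (hμ : M.vec = μ • ExteriorAlgebra.ιMulti F (halfDim V) (fun i => (φ (L.basis i) : V))) :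
    normAveraging ψ M N ∘ₗ normAveraging ψ N L =
      (quadChar F (a * μ) * ((Fintype.card F : ℂ) ^ halfDim V)⁻¹ *
        ((Nat.card (M.space.comap L.space.subtype) : ℂ)⁻¹ *
          formGaussSum ψ (twistedForm φ.toLinearMap))) • averaging ψ M L := by
  unfold normAveraging
  rw [LinearMap.smul_comp, LinearMap.comp_smul, smul_smul,
    normConst_mul_normConst hF hψ hL φ hφ ha hμ, mul_smul (_ * _) (_ * _),
    mul_smul (Nat.card _ : ℂ)⁻¹,
    ← averaging_comp_averaging (Ring.two_ne_zero hF) hψ hL hM φ hφ,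
    inv_smul_smul₀ (natCard_ne_zero L M)]

/-- Put `φ' = φ ∘ S`. The coordinate of `o_M` changes by `det S`, and the form becomes `B(·, S ·)`,
whose Gauss sum changes by `σ(det S)`. Both identifications fix `L ∩ M` pointwise, hence so does
`S`, as the comparison of Gauss sums requires. The two signs compensate. -/
theorem normAveraging_comp_eq (hF : ringChar F ≠ 2) (hψ : ψ ≠ 1)
    (hL : L.space ⊓ N.space = ⊥) (hM : M.space ⊓ N.space = ⊥)
    (hL' : L.space ⊓ N'.space = ⊥) (hM' : M.space ⊓ N'.space = ⊥) :
    normAveraging ψ M N ∘ₗ normAveraging ψ N L =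
      normAveraging ψ M N' ∘ₗ normAveraging ψ N' L := by
  obtain ⟨φ, hφ⟩ := exists_equiv_sub_mem hL hM
  obtain ⟨φ', hφ'⟩ := exists_equiv_sub_mem hL' hM'
  obtain ⟨a, ha0, ha⟩ := L.exists_vec_eq L.basis
  obtain ⟨μ, hμ0, hμ⟩ := exists_vec_eq_map φ
  obtain ⟨μ', hμ0', hμ'⟩ := exists_vec_eq_map φ'
  let S : L.space →ₗ[F] L.space := φ.symm.toLinearMap ∘ₗ φ'.toLinearMap
  have hφS : ∀ l, φ (S l) = φ' l := fun l => φ.apply_symm_apply _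
  have hμμ : μ = μ' * LinearMap.det S := by
    have h1 := alternatingMap_comp_basis ((ExteriorAlgebra.ιMulti F (halfDim V)).compLinearMap
      (M.space.subtype ∘ₗ φ.toLinearMap)) L.basis S
    have h2 : ExteriorAlgebra.ιMulti F (halfDim V) (fun i => (φ' (L.basis i) : V)) =
        LinearMap.det S •
          ExteriorAlgebra.ιMulti F (halfDim V) (fun i => (φ (L.basis i) : V)) := by
      refine Eq.trans ?_ h1
      change _ = ExteriorAlgebra.ιMulti F (halfDim V) (fun i => (φ (S (L.basis i)) : V))
      simp_rw [hφS]
    rw [hμ', h2, smul_smul] at hμ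
    refine (smul_left_injective F ?_ hμ).symm
    exact ιMulti_ne_zero ((L.basis.map φ).linearIndependent.map' _ (Submodule.ker_subtype M.space))
  have hdet : LinearMap.det S ≠ 0 := right_ne_zero_of_mul (hμμ ▸ hμ0)
  have hk := ker_twistedForm φ hφ hL
  have hQ : formGaussSum ψ (twistedForm φ'.toLinearMap) =
      quadChar F (LinearMap.det S) * formGaussSum ψ (twistedForm φ.toLinearMap) := by
    refine formGaussSum_twist hF hψ (twistedForm_isSymm φ hφ) (twistedForm_isSymm φ' hφ') S
      (fun x y => ?_) (hk.trans (ker_twistedForm φ' hφ' hL').symm) (fun x hx => ?_)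
    · change V.form x (φ' y) = V.form x (φ (S y))
      rw [hφS]
    · rw [hk] at hx
      apply φ.injective
      rw [hφS]
      exact Subtype.ext (((apply_eq_self_iff φ' hφ' hM' x).2 hx).trans
        ((apply_eq_self_iff φ hφ hM x).2 hx).symm)
  rw [normAveraging_comp hF hψ hL hM φ hφ ha hμ, normAveraging_comp hF hψ hL' hM' φ' hφ' ha hμ',
    hQ, hμμ]
  congr 1
  simp only [map_mul]
  ring

/-- With `L ∩ M = 0` the form `B` is nondegenerate, and its Gram determinant `det ω(lᵢ, φ lⱼ)` is
exactly the one occurring in the constant for `M` and `L`. -/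
theorem normAveraging_comp_of_inf_eq_bot (hF : ringChar F ≠ 2) (hψ : ψ ≠ 1)
    (hL : L.space ⊓ N.space = ⊥) (hM : M.space ⊓ N.space = ⊥) (hLM : L.space ⊓ M.space = ⊥) :
    normAveraging ψ M N ∘ₗ normAveraging ψ N L = normAveraging ψ M L := by
  obtain ⟨φ, hφ⟩ := exists_equiv_sub_mem hL hM
  obtain ⟨a, ha0, ha⟩ := L.exists_vec_eq L.basis
  obtain ⟨μ, hμ0, hμ⟩ := exists_vec_eq_map φ
  have hs := twistedForm_isSymm φ hφ
  have hcomap : M.space.comap L.space.subtype = ⊥ := by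
    rw [eq_bot_iff]
    intro l hl
    exact (Submodule.mem_bot F).2 (Subtype.ext ((Submodule.mem_bot F).1 (hLM.le ⟨l.2, hl⟩)))
  have hnd : (twistedForm φ.toLinearMap).Nondegenerate := by
    have hk := ker_twistedForm φ hφ hL
    rw [hcomap, LinearMap.ker_eq_bot'] at hk
    exact ⟨fun x hx => hk x (LinearMap.ext hx), fun x hx => hk x (LinearMap.ext fun y => by
      rw [hs.eq]; exact hx y)⟩
  rw [normAveraging_comp hF hψ hL hM φ hφ ha hμ, formGaussSum_eq hF hψ L.basis _ hs hnd, hcomap,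
    normAveraging, normConst_eq ψ M L ha hμ]
  have hmat : LinearMap.BilinForm.toMatrix L.basis (twistedForm φ.toLinearMap) =
      Matrix.of fun i j => V.form (L.basis i) (φ (L.basis j)) := by
    ext i j
    rw [LinearMap.BilinForm.toMatrix_apply]
    rfl
  rw [hmat, Nat.card_unique, Nat.cast_one, inv_one, one_mul, Fintype.card_fin, map_mul _ (a * μ),
    div_pow]
  congr 1
  ring

/-- Here `φ = id` and `B = 0`, so the Gauss sum `|L|` cancels `|L ∩ L|`. Averaging an `L`-invariant
function over `L` gives `q^n`, which cancels the constant. -/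
theorem normAveraging_comp_self (hF : ringChar F ≠ 2) (hψ : ψ ≠ 1)
    (hL : L.space ⊓ N.space = ⊥) :
    normAveraging ψ L N ∘ₗ normAveraging ψ N L = LinearMap.id := by
  obtain ⟨a, ha0, ha⟩ := L.exists_vec_eq L.basis
  have hB : twistedForm (L := L) (M := L) (LinearEquiv.refl F L.space).toLinearMap = 0 :=
    LinearMap.ext fun x => LinearMap.ext fun y => L.form_eq_zero x.2 y.2
  have hcomap : L.space.comap L.space.subtype = ⊤ := by
    rw [eq_top_iff]
    exact fun l _ => l.2
  have hcard : (Fintype.card L.space : ℂ) = (Fintype.card F : ℂ) ^ halfDim V := by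
    rw [Module.card_eq_pow_finrank (K := F), L.finrank_space, Nat.cast_pow]
  have h0 : (Fintype.card L.space : ℂ) ≠ 0 := by exact_mod_cast Fintype.card_ne_zero
  rw [normAveraging_comp hF hψ hL hL (LinearEquiv.refl F L.space)
    (fun l => by simp) ha ha, hB, formGaussSum_zero, hcomap, map_mul, quadChar_mul_self ha0,
    ← hcard, Nat.card_congr (Submodule.topEquiv (R := F) (M := L.space)).toEquiv,
    Nat.card_eq_fintype_card]
  refine LinearMap.ext fun f => ?_
  rw [LinearMap.smul_apply, averaging_self, smul_smul, inv_mul_cancel₀ h0, one_mul, mul_one,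
    inv_mul_cancel₀ h0, one_smul, LinearMap.id_apply]

variable (ψ) in
/-- The canonical system of intertwining morphisms, through a common complement. -/
noncomputable def canonicalSystem (hF : ringChar F ≠ 2) (M L : OrientedLagrangian V) :
    model ψ L.space →ₗ[ℂ] model ψ M.space :=
  -- Only a complement of `M` and `L` is needed; the third slot repeats `L`.
  let P := (exists_transverse (Ring.two_ne_zero hF) M L L).choose
  normAveraging ψ M P ∘ₗ normAveraging ψ P L

theorem canonicalSystem_eq (hF : ringChar F ≠ 2) (hψ : ψ ≠ 1) (hM : M.space ⊓ N.space = ⊥)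
    (hL : L.space ⊓ N.space = ⊥) :
    canonicalSystem ψ hF M L = normAveraging ψ M N ∘ₗ normAveraging ψ N L := by
  obtain ⟨h1, h2, -⟩ := (exists_transverse (Ring.two_ne_zero hF) M L L).choose_spec
  exact normAveraging_comp_eq hF hψ h2 h1 hL hM

theorem isCanonicalSystem_canonicalSystem (hF : ringChar F ≠ 2) (hψ : ψ ≠ 1) (V : SympSpace F) :
    IsCanonicalSystem ψ V (canonicalSystem ψ hF) where
  intertwining M L h := by
    have key : ∀ M L : OrientedLagrangian V, normAveraging ψ M L ∘ₗ modelRep ψ L.space h =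
        modelRep ψ M.space h ∘ₗ normAveraging ψ M L := fun M L => by
      rw [normAveraging, LinearMap.smul_comp, averaging_intertwining, LinearMap.comp_smul]
    unfold canonicalSystem
    rw [LinearMap.comp_assoc, key, ← LinearMap.comp_assoc, key, LinearMap.comp_assoc]
  restriction M L h := by
    obtain ⟨P, h1, h2, -⟩ := exists_transverse (Ring.two_ne_zero hF) M L L
    rw [canonicalSystem_eq hF hψ h1 h2, normAveraging_comp_of_inf_eq_bot hF hψ h2 h1 h]
    rfl
  multiplicative N M L := by
    -- With one `P` transverse to all three, the inner factor `F_{P,M} F_{M,P}` of the composite is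
    -- the identity.
    obtain ⟨P, h1, h2, h3⟩ := exists_transverse (Ring.two_ne_zero hF) N M L
    rw [canonicalSystem_eq hF hψ h1 h3, canonicalSystem_eq hF hψ h1 h2,
      canonicalSystem_eq hF hψ h2 h3, LinearMap.comp_assoc,
      ← LinearMap.comp_assoc (normAveraging ψ P L) (normAveraging ψ M P),
      normAveraging_comp_self hF hψ (by rw [inf_comm]; exact h2), LinearMap.id_comp]

theorem IsCanonicalSystem.eq_of_inf_eq_bot
    {T : ∀ M L : OrientedLagrangian V, model ψ L.space →ₗ[ℂ] model ψ M.space}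
    (hT : IsCanonicalSystem ψ V T) (hM : M.space ⊓ N.space = ⊥) (hL : L.space ⊓ N.space = ⊥) :
    T M L = normAveraging ψ M N ∘ₗ normAveraging ψ N L := by
  rw [hT.multiplicative M N L, hT.restriction N L hL,
    hT.restriction M N (by rw [inf_comm]; exact hM)]
  rfl

theorem IsCanonicalSystem.eq_canonicalSystem (hF : ringChar F ≠ 2)
    {T : ∀ M L : OrientedLagrangian V, model ψ L.space →ₗ[ℂ] model ψ M.space}
    (hT : IsCanonicalSystem ψ V T) : T = canonicalSystem ψ hF := by
  funext M L
  obtain ⟨h1, h2, -⟩ := (exists_transverse (Ring.two_ne_zero hF) M L L).choose_spec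
  exact hT.eq_of_inf_eq_bot h1 h2

theorem existsUnique_isCanonicalSystem (hF : ringChar F ≠ 2) (hψ : ψ ≠ 1) (V : SympSpace F) :
    ∃! T, IsCanonicalSystem ψ V T :=
  ⟨_, isCanonicalSystem_canonicalSystem hF hψ V, fun _ hT => hT.eq_canonicalSystem hF⟩

end CanonicalSystem

end SympSpace

namespace SympSpace

open Heisenberg OrientedLagrangian

/-! ### A canonical family is determined by its value at one Lagrangian. -/

section Evaluation

variable {F : Type} [Field F] [Fintype F] [DecidableEq F] {ψ : AddChar F ℂ} {V : SympSpace F}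

theorem canonicalSystem_self (hF : ringChar F ≠ 2) (hψ : ψ ≠ 1) (L : OrientedLagrangian V) :
    canonicalSystem ψ hF L L = LinearMap.id := by
  obtain ⟨P, h, -⟩ := exists_transverse (Ring.two_ne_zero hF) L L L
  rw [canonicalSystem_eq hF hψ h h, normAveraging_comp_self hF hψ h]

theorem canonicalSystem_apply (hF : ringChar F ≠ 2) (hψ : ψ ≠ 1) (v : canonicalSpace ψ V)
    (M L : OrientedLagrangian V) : canonicalSystem ψ hF M L (v.1 L) = v.1 M :=
  v.2 _ (isCanonicalSystem_canonicalSystem hF hψ V) M L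

/-- Evaluation of canonical families at an oriented Lagrangian. -/
noncomputable def evalEquiv (hF : ringChar F ≠ 2) (hψ : ψ ≠ 1) (L : OrientedLagrangian V) :
    canonicalSpace ψ V ≃ₗ[ℂ] model ψ L.space where
  toFun v := v.1 L
  map_add' _ _ := rfl
  map_smul' _ _ := rfl
  invFun f := ⟨fun M => canonicalSystem ψ hF M L f, fun T hT N M => by
    rw [hT.eq_canonicalSystem hF]
    exact (LinearMap.congr_fun
      ((isCanonicalSystem_canonicalSystem hF hψ V).multiplicative N M L) f).symm⟩
  left_inv v := Subtype.ext (funext fun M => canonicalSystem_apply hF hψ v M L)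
  right_inv f := by
    change canonicalSystem ψ hF L L f = f
    rw [canonicalSystem_self hF hψ]
    rfl

theorem evalEquiv_symm_apply (hF : ringChar F ≠ 2) (hψ : ψ ≠ 1) (L M : OrientedLagrangian V)
    (f : model ψ L.space) :
    ((evalEquiv hF hψ L).symm f).1 M = canonicalSystem ψ hF M L f := rfl

/-- This allows identities in `ℋ(V)` to be tested at one convenient Lagrangian, for instance a
product. -/
theorem canonicalSpace_ext (hF : ringChar F ≠ 2) (hψ : ψ ≠ 1) (L : OrientedLagrangian V)
    {v w : canonicalSpace ψ V} (h : ∀ k, (v.1 L).1 k = (w.1 L).1 k) : v = w :=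
  (evalEquiv hF hψ L).injective (Subtype.ext (funext h))

end Evaluation

/-! ### Products of oriented Lagrangians. -/

section Product

variable {F : Type} [Field F] (V₁ V₂ : SympSpace F)

/-- The inclusion of the first factor. -/
def inl : V₁ →ₗ[F] V₁.prod V₂ := LinearMap.inl F V₁ V₂

/-- The inclusion of the second factor. -/
def inr : V₂ →ₗ[F] V₁.prod V₂ := LinearMap.inr F V₁ V₂

variable {V₁ V₂}

/-- The product of two subspaces. -/
def prodSpace (A : Submodule F V₁) (B : Submodule F V₂) : Submodule F (V₁.prod V₂) :=
  (A.prod B : Submodule F (V₁ × V₂))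

/-- A product of subspaces is equivalent to the product of the underlying spaces. -/
def prodSpaceEquiv (A : Submodule F V₁) (B : Submodule F V₂) : (A × B) ≃ₗ[F] prodSpace A B where
  toFun x := ⟨(x.1.1, x.2.1), x.1.2, x.2.2⟩
  map_add' _ _ := rfl
  map_smul' _ _ := rfl
  invFun x := (⟨x.1.1, x.2.1⟩, ⟨x.1.2, x.2.2⟩)
  left_inv _ := rfl
  right_inv _ := rfl

/-- The basis of a product of subspaces, ordered with the first factor first. -/
noncomputable def prodSpaceBasis {A : Submodule F V₁} {B : Submodule F V₂} {m n : ℕ}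
    (a : Module.Basis (Fin m) F A) (b : Module.Basis (Fin n) F B) :
    Module.Basis (Fin (m + n)) F (prodSpace A B) :=
  ((a.prod b).map (prodSpaceEquiv A B)).reindex finSumFinEquiv

/-- The concatenation of two families of vectors. -/
def appendVec {m n : ℕ} (x : Fin m → V₁) (y : Fin n → V₂) : Fin (m + n) → V₁.prod V₂ :=
  Fin.append (fun i => inl V₁ V₂ (x i)) (fun i => inr V₁ V₂ (y i))

theorem coe_prodSpaceBasis {A : Submodule F V₁} {B : Submodule F V₂} {m n : ℕ}
    (a : Module.Basis (Fin m) F A) (b : Module.Basis (Fin n) F B) :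
    (fun i => (prodSpaceBasis a b i : V₁.prod V₂)) =
      appendVec (fun i => (a i : V₁)) (fun i => (b i : V₂)) := by
  funext i
  obtain ⟨i, rfl⟩ := finSumFinEquiv.surjective i
  rw [prodSpaceBasis, Module.Basis.reindex_apply, Equiv.symm_apply_apply, Module.Basis.map_apply]
  cases i with
  | inl i =>
    rw [finSumFinEquiv_apply_left, appendVec, Fin.append_left]
    refine Prod.ext ?_ ?_
    · exact congrArg Subtype.val (Module.Basis.prod_apply_inl_fst a b i)
    · exact congrArg Subtype.val (Module.Basis.prod_apply_inl_snd a b i)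
  | inr i =>
    rw [finSumFinEquiv_apply_right, appendVec, Fin.append_right]
    refine Prod.ext ?_ ?_
    · exact congrArg Subtype.val (Module.Basis.prod_apply_inr_fst a b i)
    · exact congrArg Subtype.val (Module.Basis.prod_apply_inr_snd a b i)

theorem ιMulti_appendVec {m n : ℕ} (x : Fin m → V₁) (y : Fin n → V₂) :
    ExteriorAlgebra.ιMulti F (m + n) (appendVec x y) =
      ExteriorAlgebra.map (inl V₁ V₂) (ExteriorAlgebra.ιMulti F m x) *
        ExteriorAlgebra.map (inr V₁ V₂) (ExteriorAlgebra.ιMulti F n y) := by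
  rw [ExteriorAlgebra.map_apply_ιMulti, ExteriorAlgebra.map_apply_ιMulti,
    ExteriorAlgebra.ιMulti_apply, ExteriorAlgebra.ιMulti_apply, ExteriorAlgebra.ιMulti_apply,
    ← List.prod_append, ← List.ofFn_fin_append]
  congr 2
  funext i
  obtain ⟨i, rfl⟩ := finSumFinEquiv.surjective i
  cases i <;> simp [appendVec]

theorem map_smul_mul_map_smul {X Y W : Type} [AddCommGroup X] [Module F X] [AddCommGroup Y]
    [Module F Y] [AddCommGroup W] [Module F W] (f : X →ₗ[F] W) (g : Y →ₗ[F] W) (a b : F)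
    (u : ExteriorAlgebra F X) (v : ExteriorAlgebra F Y) :
    ExteriorAlgebra.map f (a • u) * ExteriorAlgebra.map g (b • v) =
      (a * b) • (ExteriorAlgebra.map f u * ExteriorAlgebra.map g v) := by
  rw [map_smul, map_smul, smul_mul_smul_comm]

theorem map_smul_mul_map_smul_ιMulti {m n : ℕ} (x : Fin m → V₁) (y : Fin n → V₂) (a b : F) :
    ExteriorAlgebra.map (inl V₁ V₂) (a • ExteriorAlgebra.ιMulti F m x) *
        ExteriorAlgebra.map (inr V₁ V₂) (b • ExteriorAlgebra.ιMulti F n y) =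
      (a * b) • ExteriorAlgebra.ιMulti F (m + n) (appendVec x y) :=
  (map_smul_mul_map_smul _ _ _ _ _ _).trans (congrArg _ (ιMulti_appendVec x y).symm)

theorem form_inl_inl (x x' : V₁) :
    (V₁.prod V₂).form (inl V₁ V₂ x) (inl V₁ V₂ x') = V₁.form x x' := by
  change V₁.form x x' + V₂.form 0 0 = _
  rw [map_zero, add_zero]

theorem form_inr_inr (y y' : V₂) :
    (V₁.prod V₂).form (inr V₁ V₂ y) (inr V₁ V₂ y') = V₂.form y y' := by
  change V₁.form 0 0 + V₂.form y y' = _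
  rw [map_zero, zero_add]

theorem form_inl_inr (x : V₁) (y : V₂) :
    (V₁.prod V₂).form (inl V₁ V₂ x) (inr V₁ V₂ y) = 0 := by
  change V₁.form x 0 + V₂.form 0 y = _
  rw [map_zero, map_zero, LinearMap.zero_apply, add_zero]

theorem form_inr_inl (x : V₁) (y : V₂) :
    (V₁.prod V₂).form (inr V₁ V₂ y) (inl V₁ V₂ x) = 0 := by
  change V₁.form 0 x + V₂.form y 0 = _
  rw [map_zero, map_zero, LinearMap.zero_apply, add_zero]

/-- The two factors are orthogonal, so the matrix is block diagonal. -/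
theorem det_form_appendVec {m n : ℕ} (x x' : Fin m → V₁) (y y' : Fin n → V₂) :
    (Matrix.of fun i j => (V₁.prod V₂).form (appendVec x y i) (appendVec x' y' j)).det =
      (Matrix.of fun i j => V₁.form (x i) (x' j)).det *
        (Matrix.of fun i j => V₂.form (y i) (y' j)).det := by
  rw [← Matrix.det_fromBlocks_zero₂₁ _ 0, ← Matrix.det_submatrix_equiv_self finSumFinEquiv]
  congr 1
  ext i j
  cases i <;> cases j <;>
    simp [appendVec, form_inl_inl, form_inr_inr, form_inl_inr, form_inr_inl]

theorem orthogonal_prodSpace (A : Submodule F V₁) (B : Submodule F V₂) :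
    (V₁.prod V₂).form.orthogonal (prodSpace A B) =
      prodSpace (V₁.form.orthogonal A) (V₂.form.orthogonal B) := by
  ext x
  constructor
  · intro h
    refine ⟨fun a ha => ?_, fun b hb => ?_⟩
    · have h1 : V₁.form a x.1 + V₂.form 0 x.2 = 0 := h (a, 0) ⟨ha, B.zero_mem⟩
      rwa [map_zero, LinearMap.zero_apply, add_zero] at h1
    · have h1 : V₁.form 0 x.1 + V₂.form b x.2 = 0 := h (0, b) ⟨A.zero_mem, hb⟩
      rwa [map_zero, LinearMap.zero_apply, zero_add] at h1
  · rintro ⟨h1, h2⟩ y ⟨hy1, hy2⟩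
    change V₁.form y.1 x.1 + V₂.form y.2 x.2 = 0
    rw [h1 _ hy1, h2 _ hy2, add_zero]

theorem prodSpace_inf_prodSpace (A A' : Submodule F V₁) (B B' : Submodule F V₂) :
    prodSpace A B ⊓ prodSpace A' B' = prodSpace (A ⊓ A') (B ⊓ B') :=
  Submodule.prod_inf_prod A A' B B'

namespace OrientedLagrangian

theorem smul_ιMulti_coe_basis_mem {W : Type} [AddCommGroup W] [Module F W] (N : Submodule F W)
    {n : ℕ}
    (b : Module.Basis (Fin n) F N) (c : F) :
    c • ExteriorAlgebra.ιMulti F n (fun i => (b i : W)) ∈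
      (⋀[F]^(Module.finrank F N) N).map (ExteriorAlgebra.map N.subtype).toLinearMap := by
  have hn : Module.finrank F N = n := by
    rw [Module.finrank_eq_card_basis b, Fintype.card_fin]
  rw [hn]
  exact Submodule.smul_mem _ _ ⟨ExteriorAlgebra.ιMulti F n b, (exteriorPower.ιMulti F n b).2,
    ExteriorAlgebra.map_apply_ιMulti _ _⟩

theorem smul_ιMulti_coe_basis_ne_zero {W : Type} [AddCommGroup W] [Module F W]
    (N : Submodule F W) {n : ℕ} (b : Module.Basis (Fin n) F N) {c : F} (hc : c ≠ 0) :
    c • ExteriorAlgebra.ιMulti F n (fun i => (b i : W)) ≠ 0 :=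
  smul_ne_zero hc (ιMulti_ne_zero (b.linearIndependent.map' _ (Submodule.ker_subtype N)))

/-- The product of two oriented Lagrangians, with orientation `o₁ ∧ o₂`. -/
noncomputable def prod (L₁ : OrientedLagrangian V₁) (L₂ : OrientedLagrangian V₂) :
    OrientedLagrangian (V₁.prod V₂) where
  space := prodSpace L₁.space L₂.space
  lagrangian := by rw [orthogonal_prodSpace, L₁.lagrangian, L₂.lagrangian]
  vec := ExteriorAlgebra.map (inl V₁ V₂) L₁.vec * ExteriorAlgebra.map (inr V₁ V₂) L₂.vec
  vec_mem := by
    obtain ⟨a, -, ha⟩ := L₁.exists_vec_eq L₁.basis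
    obtain ⟨b, -, hb⟩ := L₂.exists_vec_eq L₂.basis
    rw [ha, hb, map_smul_mul_map_smul_ιMulti, ← coe_prodSpaceBasis]
    exact smul_ιMulti_coe_basis_mem _ (prodSpaceBasis L₁.basis L₂.basis) _
  vec_ne_zero := by
    obtain ⟨a, ha0, ha⟩ := L₁.exists_vec_eq L₁.basis
    obtain ⟨b, hb0, hb⟩ := L₂.exists_vec_eq L₂.basis
    rw [ha, hb, map_smul_mul_map_smul_ιMulti, ← coe_prodSpaceBasis]
    exact smul_ιMulti_coe_basis_ne_zero _ (prodSpaceBasis L₁.basis L₂.basis)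
      (mul_ne_zero ha0 hb0)

theorem prod_vec_eq (L₁ : OrientedLagrangian V₁) (L₂ : OrientedLagrangian V₂) {m n : ℕ}
    {x : Fin m → V₁} {y : Fin n → V₂} {a b : F} (hx : L₁.vec = a • ExteriorAlgebra.ιMulti F m x)
    (hy : L₂.vec = b • ExteriorAlgebra.ιMulti F n y) :
    (L₁.prod L₂).vec = (a * b) • ExteriorAlgebra.ιMulti F (m + n) (appendVec x y) := by
  change ExteriorAlgebra.map (inl V₁ V₂) L₁.vec * ExteriorAlgebra.map (inr V₁ V₂) L₂.vec = _
  rw [hx, hy, map_smul_mul_map_smul_ιMulti]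

theorem prod_inf_eq_bot {L₁ M₁ : OrientedLagrangian V₁} {L₂ M₂ : OrientedLagrangian V₂}
    (h₁ : L₁.space ⊓ M₁.space = ⊥) (h₂ : L₂.space ⊓ M₂.space = ⊥) :
    (L₁.prod L₂).space ⊓ (M₁.prod M₂).space = ⊥ := by
  change prodSpace _ _ ⊓ prodSpace _ _ = ⊥
  rw [prodSpace_inf_prodSpace, h₁, h₂]
  exact Submodule.prod_bot

/-- Reading both sides as dimensions of Lagrangians avoids parity questions in the truncated
division by `2`. -/
theorem halfDim_prod (L₁ : OrientedLagrangian V₁) (L₂ : OrientedLagrangian V₂) :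
    halfDim (V₁.prod V₂) = halfDim V₁ + halfDim V₂ := by
  rw [← (L₁.prod L₂).finrank_space]
  exact (Module.finrank_eq_card_basis (prodSpaceBasis L₁.basis L₂.basis)).trans
    (Fintype.card_fin _)

theorem prod_map {W₁ W₂ : SympSpace F} (f₁ : V₁ ⟶ W₁) (f₂ : V₂ ⟶ W₂)
    (L₁ : OrientedLagrangian V₁) (L₂ : OrientedLagrangian V₂) :
    (L₁.prod L₂).map (prodMap f₁ f₂) = (L₁.map f₁).prod (L₂.map f₂) := by
  refine OrientedLagrangian.ext ?_ ?_
  · refine le_antisymm ?_ ?_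
    · rintro _ ⟨x, hx, rfl⟩
      exact ⟨⟨x.1, hx.1, rfl⟩, ⟨x.2, hx.2, rfl⟩⟩
    · rintro ⟨_, _⟩ ⟨⟨x, hx, rfl⟩, ⟨y, hy, rfl⟩⟩
      exact ⟨(x, y), ⟨hx, hy⟩, rfl⟩
  · have h₁ : (prodMap f₁ f₂).toEquiv.toLinearMap ∘ₗ inl V₁ V₂ =
        inl W₁ W₂ ∘ₗ f₁.toEquiv.toLinearMap :=
      LinearMap.ext fun x => Prod.ext rfl f₂.toEquiv.map_zero
    have h₂ : (prodMap f₁ f₂).toEquiv.toLinearMap ∘ₗ inr V₁ V₂ =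
        inr W₁ W₂ ∘ₗ f₂.toEquiv.toLinearMap :=
      LinearMap.ext fun x => Prod.ext f₁.toEquiv.map_zero rfl
    change ExteriorAlgebra.map _ (ExteriorAlgebra.map (inl V₁ V₂) L₁.vec *
      ExteriorAlgebra.map (inr V₁ V₂) L₂.vec) = ExteriorAlgebra.map (inl W₁ W₂)
        (ExteriorAlgebra.map _ L₁.vec) * ExteriorAlgebra.map (inr W₁ W₂)
          (ExteriorAlgebra.map _ L₂.vec)
    rw [map_mul]
    simp only [← AlgHom.comp_apply, ExteriorAlgebra.map_comp_map, h₁, h₂]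

end OrientedLagrangian

end Product

end SympSpace

namespace SympSpace

open Heisenberg OrientedLagrangian

/-! ### Models as spaces of functions on a complementary Lagrangian. -/

section Model

variable {F : Type} [Field F] {ψ : AddChar F ℂ} {V : SympSpace F}

theorem model_apply {L : Submodule F V} (f : model ψ L) (h : Heisenberg V) :
    f.1 h = ψ h.cen * f.1 (ofVec h.vec) := by
  rw [← f.2.1]
  exact congrArg f.1 (Heisenberg.ext (by simp) (by simp))

theorem model_apply_ofVec_add {L : Submodule F V} (f : model ψ L) (x y : V) :
    ψ (2⁻¹ * V.form x y) * f.1 (ofVec (x + y)) = f.1 (ofVec x * ofVec y) := by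
  rw [model_apply f (ofVec x * ofVec y)]
  simp

/-- Restriction to a complementary Lagrangian identifies the model with a space of functions. -/
noncomputable def modelEquiv (L M : OrientedLagrangian V) (h : L.space ⊓ M.space = ⊥) :
    model ψ L.space ≃ₗ[ℂ] (M.space → ℂ) :=
  let e := (Submodule.prodEquivOfIsCompl _ _ (isCompl h)).symm
  have he : ∀ v, v = ((e v).1 : V) + (e v).2 := fun v =>
    ((Submodule.prodEquivOfIsCompl _ _ (isCompl h)).apply_symm_apply v).symm
  have heL : ∀ l : L.space, e l = (l, 0) := fun l =>
    Submodule.prodEquivOfIsCompl_symm_apply_left _ _ (isCompl h) l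
  have heM : ∀ m : M.space, e m = (0, m) := fun m =>
    Submodule.prodEquivOfIsCompl_symm_apply_right _ _ (isCompl h) m
  { toFun := fun f m => f.1 (ofVec m)
    map_add' := fun _ _ => rfl
    map_smul' := fun _ _ => rfl
    -- For `v = l + m` one has `(v, z) = (z - ½ ω(l, m)) · l · m`, so the equivariance of `f` forces
    -- this formula.
    invFun := fun g =>
      ⟨fun k => ψ (k.cen - 2⁻¹ * V.form (e k.vec).1 (e k.vec).2) * g (e k.vec).2, by
      refine ⟨fun z k => ?_, fun l hl k => ?_⟩
      · rw [← mul_assoc, ← AddChar.map_add_eq_mul]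
        simp only [mul_vec, mul_cen, ofCen_vec, ofCen_cen, zero_add, map_zero,
          LinearMap.zero_apply, mul_zero, add_zero]
        rw [add_sub_assoc]
      · have h1 : e (l + k.vec) = ((⟨l, hl⟩ : L.space) + (e k.vec).1, (e k.vec).2) := by
          rw [map_add, heL ⟨l, hl⟩]
          simp [Prod.ext_iff]
        have h2 : V.form l k.vec = V.form l (e k.vec).2 := by
          conv_lhs => rw [he k.vec]
          rw [map_add, L.form_eq_zero hl (e k.vec).1.2, zero_add]
        simp only [mul_vec, mul_cen, ofVec_vec, ofVec_cen, zero_add]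
        rw [h1, h2]
        congr 2
        simp only [Submodule.coe_add, map_add, LinearMap.add_apply]
        ring⟩
    left_inv := fun f => by
      refine Subtype.ext (funext fun k => ?_)
      change ψ (k.cen - 2⁻¹ * V.form (e k.vec).1 (e k.vec).2) * f.1 (ofVec (e k.vec).2) = f.1 k
      rw [← f.2.2 _ (e k.vec).1.2, ← f.2.1]
      refine congrArg f.1 (Heisenberg.ext ?_ (by simp))
      simp only [mul_vec, ofVec_vec, ofCen_vec, zero_add]
      exact (he k.vec).symm
    right_inv := fun g => by
      funext m
      change ψ (0 - 2⁻¹ * V.form (e m).1 (e m).2) * g (e m).2 = g m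
      rw [heM]
      simp }

theorem modelEquiv_apply (L M : OrientedLagrangian V) (h : L.space ⊓ M.space = ⊥)
    (f : model ψ L.space) (m : M.space) : modelEquiv L M h f m = f.1 (ofVec m) := rfl

end Model

/-! ### The external product and its compatibility with the canonical systems. -/

section Box

variable {F : Type} [Field F] {ψ : AddChar F ℂ} {V₁ V₂ : SympSpace F}

/-- The external product of two model functions. -/
noncomputable def box (L₁ : OrientedLagrangian V₁) (L₂ : OrientedLagrangian V₂) :
    model ψ L₁.space →ₗ[ℂ] model ψ L₂.space →ₗ[ℂ] model ψ (L₁.prod L₂).space :=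
  LinearMap.mk₂ ℂ
    (fun f g => ⟨fun h => ψ h.cen * (f.1 (ofVec h.vec.1) * g.1 (ofVec h.vec.2)), by
      refine ⟨fun z h => ?_, fun l hl h => ?_⟩
      · rw [← mul_assoc, ← AddChar.map_add_eq_mul]
        simp only [mul_vec, mul_cen, ofCen_vec, ofCen_cen, zero_add, map_zero,
          LinearMap.zero_apply, mul_zero, add_zero]
      · change ψ (ofVec l * h).cen *
          (f.1 (ofVec (l.1 + h.vec.1)) * g.1 (ofVec (l.2 + h.vec.2))) =
            ψ h.cen * (f.1 (ofVec h.vec.1) * g.1 (ofVec h.vec.2))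
        rw [← f.2.2 l.1 hl.1 (ofVec h.vec.1), ← g.2.2 l.2 hl.2 (ofVec h.vec.2),
          ← model_apply_ofVec_add f, ← model_apply_ofVec_add g]
        have e : (ofVec l * h).cen = h.cen + 2⁻¹ * V₁.form l.1 h.vec.1 +
            2⁻¹ * V₂.form l.2 h.vec.2 := by
          change 0 + h.cen + 2⁻¹ * (V₁.form l.1 h.vec.1 + V₂.form l.2 h.vec.2) = _
          ring
        rw [e, AddChar.map_add_eq_mul, AddChar.map_add_eq_mul]
        ring⟩)
    (fun f f' g => Subtype.ext (funext fun h => by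
      change ψ h.cen * ((f.1 (ofVec h.vec.1) + f'.1 (ofVec h.vec.1)) * g.1 (ofVec h.vec.2)) =
        ψ h.cen * (f.1 (ofVec h.vec.1) * g.1 (ofVec h.vec.2)) +
          ψ h.cen * (f'.1 (ofVec h.vec.1) * g.1 (ofVec h.vec.2))
      ring))
    (fun c f g => Subtype.ext (funext fun h => by
      change ψ h.cen * (c * f.1 (ofVec h.vec.1) * g.1 (ofVec h.vec.2)) =
        c * (ψ h.cen * (f.1 (ofVec h.vec.1) * g.1 (ofVec h.vec.2)))
      ring))
    (fun f g g' => Subtype.ext (funext fun h => by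
      change ψ h.cen * (f.1 (ofVec h.vec.1) * (g.1 (ofVec h.vec.2) + g'.1 (ofVec h.vec.2))) =
        ψ h.cen * (f.1 (ofVec h.vec.1) * g.1 (ofVec h.vec.2)) +
          ψ h.cen * (f.1 (ofVec h.vec.1) * g'.1 (ofVec h.vec.2))
      ring))
    (fun c f g => Subtype.ext (funext fun h => by
      change ψ h.cen * (f.1 (ofVec h.vec.1) * (c * g.1 (ofVec h.vec.2))) =
        c * (ψ h.cen * (f.1 (ofVec h.vec.1) * g.1 (ofVec h.vec.2)))
      ring))

theorem box_apply (L₁ : OrientedLagrangian V₁) (L₂ : OrientedLagrangian V₂)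
    (f : model ψ L₁.space) (g : model ψ L₂.space) (h : Heisenberg (V₁.prod V₂)) :
    (box L₁ L₂ f g).1 h = ψ h.cen * (f.1 (ofVec h.vec.1) * g.1 (ofVec h.vec.2)) := rfl

section

variable [Fintype F] {L₁ M₁ : OrientedLagrangian V₁} {L₂ M₂ : OrientedLagrangian V₂}

/-- The form on `V₁ × V₂` is a sum, so the central factor splits and the sum over `M₁ × M₂` factors.
-/
theorem averaging_box (f : model ψ L₁.space) (g : model ψ L₂.space) :
    averaging ψ (M₁.prod M₂) (L₁.prod L₂) (box L₁ L₂ f g) =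
      box M₁ M₂ (averaging ψ M₁ L₁ f) (averaging ψ M₂ L₂ g) := by
  refine Subtype.ext (funext fun h => ?_)
  rw [averaging_apply, box_apply, averaging_apply, averaging_apply, Finset.sum_mul_sum,
    Finset.mul_sum]
  simp_rw [Finset.mul_sum]
  rw [← Fintype.sum_prod_type']
  let σ : M₁.space × M₂.space ≃ (M₁.prod M₂).space := (prodSpaceEquiv M₁.space M₂.space).toEquiv
  refine (Fintype.sum_equiv σ _ _ fun m => ?_).symm
  rw [box_apply, ← model_apply_ofVec_add f, ← model_apply_ofVec_add g]
  have e : (ofVec (V := V₁.prod V₂) ((prodSpaceEquiv M₁.space M₂.space) m).1 * h).cen =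
      h.cen + 2⁻¹ * V₁.form m.1 h.vec.1 + 2⁻¹ * V₂.form m.2 h.vec.2 := by
    change 0 + h.cen + 2⁻¹ * (V₁.form m.1 h.vec.1 + V₂.form m.2 h.vec.2) = _
    ring
  change _ = ψ (ofVec (V := V₁.prod V₂) ((prodSpaceEquiv M₁.space M₂.space) m).1 * h).cen *
    (f.1 (ofVec (m.1 + h.vec.1)) * g.1 (ofVec (m.2 + h.vec.2)))
  rw [e, AddChar.map_add_eq_mul, AddChar.map_add_eq_mul]
  ring

/-- Restricting to complementary Lagrangians turns the models into function spaces, and the external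
product of two delta functions is the delta function at the pair. Thus a basis goes to a basis. -/
theorem exists_boxEquiv (h2 : (2 : F) ≠ 0) (L₁ : OrientedLagrangian V₁)
    (L₂ : OrientedLagrangian V₂) :
    ∃ e : (model ψ L₁.space ⊗[ℂ] model ψ L₂.space) ≃ₗ[ℂ] model ψ (L₁.prod L₂).space,
      ∀ f g, e (f ⊗ₜ g) = box L₁ L₂ f g := by
  classical
  obtain ⟨M₁, h₁, -⟩ := exists_transverse h2 L₁ L₁ L₁
  obtain ⟨M₂, h₂, -⟩ := exists_transverse h2 L₂ L₂ L₂
  let b₁ := Module.Basis.ofEquivFun (modelEquiv (ψ := ψ) L₁ M₁ h₁)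
  let b₂ := Module.Basis.ofEquivFun (modelEquiv (ψ := ψ) L₂ M₂ h₂)
  let σ : M₁.space × M₂.space ≃ (M₁.prod M₂).space := (prodSpaceEquiv M₁.space M₂.space).toEquiv
  let E := modelEquiv (ψ := ψ) (L₁.prod L₂) (M₁.prod M₂) (prod_inf_eq_bot h₁ h₂)
  let b := (Module.Basis.ofEquivFun E).reindex σ.symm
  let e := (b₁.tensorProduct b₂).equiv b (Equiv.refl _)
  refine ⟨e, fun f g => ?_⟩
  have hb₁ : ∀ i m, (b₁ i).1 (ofVec m.1) = (Pi.single i 1 : M₁.space → ℂ) m := fun i m => by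
    rw [← modelEquiv_apply L₁ M₁ h₁]
    simp [b₁]
  have hb₂ : ∀ i m, (b₂ i).1 (ofVec m.1) = (Pi.single i 1 : M₂.space → ℂ) m := fun i m => by
    rw [← modelEquiv_apply L₂ M₂ h₂]
    simp [b₂]
  have key : (TensorProduct.mk ℂ _ _).compr₂ e.toLinearMap = box L₁ L₂ := by
    refine b₁.ext fun i => b₂.ext fun j => ?_
    rw [LinearMap.compr₂_apply, TensorProduct.mk_apply, ← Module.Basis.tensorProduct_apply,
      LinearEquiv.coe_coe, Module.Basis.equiv_apply, Equiv.refl_apply]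
    apply E.injective
    funext m
    obtain ⟨⟨m₁, m₂⟩, rfl⟩ := σ.surjective m
    have hb : E (b (i, j)) = Pi.single (σ (i, j)) 1 := by
      simp [b]
    rw [hb]
    change _ = ψ 0 * ((b₁ i).1 (ofVec m₁.1) * (b₂ j).1 (ofVec m₂.1))
    rw [hb₁, hb₂, AddChar.map_zero_eq_one, one_mul]
    simp only [Pi.single_apply, σ.apply_eq_iff_eq, Prod.mk.injEq]
    split_ifs <;> simp_all
  exact LinearMap.congr_fun (LinearMap.congr_fun key f) g

variable [DecidableEq F]

theorem normConst_prod : normConst ψ (M₁.prod M₂) (L₁.prod L₂) =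
    normConst ψ M₁ L₁ * normConst ψ M₂ L₂ := by
  obtain ⟨a₁, -, ha₁⟩ := L₁.exists_vec_eq L₁.basis
  obtain ⟨a₂, -, ha₂⟩ := L₂.exists_vec_eq L₂.basis
  obtain ⟨b₁, -, hb₁⟩ := M₁.exists_vec_eq M₁.basis
  obtain ⟨b₂, -, hb₂⟩ := M₂.exists_vec_eq M₂.basis
  -- The half dimension of the product equals the sum only propositionally, so it is replaced by a
  -- variable `n` before bases indexed by `Fin n` are inserted.
  have key : ∀ {n : ℕ}, halfDim (V₁.prod V₂) = n → ∀ {a b : F} {l m : Fin n → V₁.prod V₂},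
      (L₁.prod L₂).vec = a • ExteriorAlgebra.ιMulti F n l →
      (M₁.prod M₂).vec = b • ExteriorAlgebra.ιMulti F n m →
      normConst ψ (M₁.prod M₂) (L₁.prod L₂) = (gaussSum₁ ψ / Fintype.card F) ^ n *
        quadChar F (a * b * (Matrix.of fun i j => (V₁.prod V₂).form (l i) (m j)).det) := by
    rintro n rfl a b l m hl hm
    exact normConst_eq ψ _ _ hl hm
  rw [key (halfDim_prod L₁ L₂) (prod_vec_eq L₁ L₂ ha₁ ha₂) (prod_vec_eq M₁ M₂ hb₁ hb₂),
    normConst_eq ψ M₁ L₁ ha₁ hb₁, normConst_eq ψ M₂ L₂ ha₂ hb₂, det_form_appendVec, pow_add]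
  simp only [map_mul]
  ring

theorem normAveraging_box (f : model ψ L₁.space) (g : model ψ L₂.space) :
    normAveraging ψ (M₁.prod M₂) (L₁.prod L₂) (box L₁ L₂ f g) =
      box M₁ M₂ (normAveraging ψ M₁ L₁ f) (normAveraging ψ M₂ L₂ g) := by
  simp only [normAveraging, LinearMap.smul_apply, averaging_box, normConst_prod, map_smul,
    smul_smul]
  rw [mul_comm]

/-- A product of common complements is a common complement of the products, so both systems can be
computed through it. -/
theorem canonicalSystem_box (hF : ringChar F ≠ 2) (hψ : ψ ≠ 1) (f : model ψ L₁.space)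
    (g : model ψ L₂.space) :
    canonicalSystem ψ hF (M₁.prod M₂) (L₁.prod L₂) (box L₁ L₂ f g) =
      box M₁ M₂ (canonicalSystem ψ hF M₁ L₁ f) (canonicalSystem ψ hF M₂ L₂ g) := by
  obtain ⟨P₁, hM₁, hL₁, -⟩ := exists_transverse (Ring.two_ne_zero hF) M₁ L₁ L₁
  obtain ⟨P₂, hM₂, hL₂, -⟩ := exists_transverse (Ring.two_ne_zero hF) M₂ L₂ L₂
  rw [canonicalSystem_eq hF hψ (prod_inf_eq_bot hM₁ hM₂) (prod_inf_eq_bot hL₁ hL₂),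
    canonicalSystem_eq hF hψ hM₁ hL₁, canonicalSystem_eq hF hψ hM₂ hL₂, LinearMap.comp_apply,
    normAveraging_box, normAveraging_box]
  rfl

end

end Box

/-! ### The tensor decomposition of the canonical space. -/

section TensorEquiv

variable {F : Type} [Field F] [Fintype F] [DecidableEq F] {ψ : AddChar F ℂ}

/-- The map is built from one choice of `L₁` and `L₂`, but compatibility with the canonical systems
gives the same formula at every product Lagrangian. Later arguments use only this formula. -/
theorem exists_tensorEquiv (hF : ringChar F ≠ 2) (hψ : ψ ≠ 1) (V₁ V₂ : SympSpace F) :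
    ∃ e : (canonicalSpace ψ V₁ ⊗[ℂ] canonicalSpace ψ V₂) ≃ₗ[ℂ] canonicalSpace ψ (V₁.prod V₂),
      ∀ v w (M₁ : OrientedLagrangian V₁) (M₂ : OrientedLagrangian V₂),
        (e (v ⊗ₜ w)).1 (M₁.prod M₂) = box M₁ M₂ (v.1 M₁) (w.1 M₂) := by
  obtain ⟨L₁⟩ := OrientedLagrangian.nonempty (Ring.two_ne_zero hF) V₁
  obtain ⟨L₂⟩ := OrientedLagrangian.nonempty (Ring.two_ne_zero hF) V₂
  obtain ⟨b, hb⟩ := exists_boxEquiv (ψ := ψ) (Ring.two_ne_zero hF) L₁ L₂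
  refine ⟨(TensorProduct.congr (evalEquiv hF hψ L₁) (evalEquiv hF hψ L₂)).trans
    (b.trans (evalEquiv hF hψ (L₁.prod L₂)).symm), fun v w M₁ M₂ => ?_⟩
  rw [LinearEquiv.trans_apply, LinearEquiv.trans_apply, TensorProduct.congr_tmul, hb,
    evalEquiv_symm_apply, canonicalSystem_box hF hψ]
  congr 1
  · exact congrArg _ (canonicalSystem_apply hF hψ v M₁ L₁)
  · exact canonicalSystem_apply hF hψ w M₂ L₂

/-- The isomorphism `ℋ(V₁) ⊗ ℋ(V₂) ≃ ℋ(V₁ × V₂)`. -/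
noncomputable def tensorEquiv (hF : ringChar F ≠ 2) (hψ : ψ ≠ 1) (V₁ V₂ : SympSpace F) :
    (canonicalSpace ψ V₁ ⊗[ℂ] canonicalSpace ψ V₂) ≃ₗ[ℂ] canonicalSpace ψ (V₁.prod V₂) :=
  (exists_tensorEquiv hF hψ V₁ V₂).choose

theorem tensorEquiv_tmul (hF : ringChar F ≠ 2) (hψ : ψ ≠ 1) {V₁ V₂ : SympSpace F}
    (v : canonicalSpace ψ V₁) (w : canonicalSpace ψ V₂) (M₁ : OrientedLagrangian V₁)
    (M₂ : OrientedLagrangian V₂) :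
    (tensorEquiv hF hψ V₁ V₂ (v ⊗ₜ w)).1 (M₁.prod M₂) = box M₁ M₂ (v.1 M₁) (w.1 M₂) :=
  (exists_tensorEquiv hF hψ V₁ V₂).choose_spec v w M₁ M₂

end TensorEquiv

end SympSpace

/-! ### Naturality, coherence, and the Weil representation. -/

namespace SympSpace

open Heisenberg OrientedLagrangian

namespace OrientedLagrangian

variable {F : Type} [Field F]

/-- On orientations this is associativity of the wedge product. The inverse associator appears
because the functor is contravariant. -/
theorem prod_map_associator_inv {V₁ V₂ V₃ : SympSpace F} (L₁ : OrientedLagrangian V₁)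
    (L₂ : OrientedLagrangian V₂) (L₃ : OrientedLagrangian V₃) :
    (L₁.prod (L₂.prod L₃)).map (α_ V₁ V₂ V₃).inv = (L₁.prod L₂).prod L₃ := by
  refine OrientedLagrangian.ext ?_ ?_
  · refine le_antisymm ?_ ?_
    · rintro _ ⟨x, hx, rfl⟩
      exact ⟨⟨hx.1, hx.2.1⟩, hx.2.2⟩
    · rintro ⟨⟨x, y⟩, z⟩ ⟨⟨hx, hy⟩, hz⟩
      exact ⟨(x, y, z), ⟨hx, hy, hz⟩, rfl⟩
  · have h₁ : (α_ V₁ V₂ V₃).inv.toEquiv.toLinearMap ∘ₗ inl V₁ (V₂.prod V₃) =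
        inl (V₁.prod V₂) V₃ ∘ₗ inl V₁ V₂ := rfl
    have h₂ : (α_ V₁ V₂ V₃).inv.toEquiv.toLinearMap ∘ₗ inr V₁ (V₂.prod V₃) ∘ₗ inl V₂ V₃ =
        inl (V₁.prod V₂) V₃ ∘ₗ inr V₁ V₂ := rfl
    have h₃ : (α_ V₁ V₂ V₃).inv.toEquiv.toLinearMap ∘ₗ inr V₁ (V₂.prod V₃) ∘ₗ inr V₂ V₃ =
        inr (V₁.prod V₂) V₃ := rfl
    change ExteriorAlgebra.map _ (ExteriorAlgebra.map (inl V₁ (V₂.prod V₃)) L₁.vec *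
      ExteriorAlgebra.map (inr V₁ (V₂.prod V₃)) (ExteriorAlgebra.map (inl V₂ V₃) L₂.vec *
        ExteriorAlgebra.map (inr V₂ V₃) L₃.vec)) =
      ExteriorAlgebra.map (inl (V₁.prod V₂) V₃) (ExteriorAlgebra.map (inl V₁ V₂) L₁.vec *
        ExteriorAlgebra.map (inr V₁ V₂) L₂.vec) *
        ExteriorAlgebra.map (inr (V₁.prod V₂) V₃) L₃.vec
    simp only [map_mul, ← mul_assoc]
    simp only [← AlgHom.comp_apply, ExteriorAlgebra.map_comp_map]
    rw [← h₁, ← h₂, ← h₃]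

/-- The Lagrangian of the zero space, with orientation `1`. -/
noncomputable def zero (F : Type) [Field F] : OrientedLagrangian (SympSpace.zero F) where
  space := ⊥
  lagrangian := Subsingleton.elim (α := Submodule F PUnit) _ _
  vec := 1
  vec_mem := by
    refine ⟨1, ?_, map_one (ExteriorAlgebra.map _)⟩
    rw [finrank_bot, ExteriorAlgebra.exteriorPower, pow_zero]
    exact Submodule.one_le.1 le_rfl
  vec_ne_zero := one_ne_zero

/-- Orienting the zero space by `1` makes `1 ∧ o = o`. -/
theorem map_leftUnitor_inv {V : SympSpace F} (L : OrientedLagrangian V) :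
    L.map (λ_ V).inv = (zero F).prod L := by
  refine OrientedLagrangian.ext ?_ ?_
  · refine le_antisymm ?_ ?_
    · rintro _ ⟨x, hx, rfl⟩
      exact ⟨rfl, hx⟩
    · rintro ⟨_, x⟩ ⟨-, hx⟩
      exact ⟨x, hx, rfl⟩
  · change ExteriorAlgebra.map _ L.vec = ExteriorAlgebra.map (inl (SympSpace.zero F) V) 1 *
      ExteriorAlgebra.map (inr (SympSpace.zero F) V) L.vec
    rw [map_one, one_mul]
    rfl

theorem map_rightUnitor_inv {V : SympSpace F} (L : OrientedLagrangian V) :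
    L.map (ρ_ V).inv = L.prod (zero F) := by
  refine OrientedLagrangian.ext ?_ ?_
  · refine le_antisymm ?_ ?_
    · rintro _ ⟨x, hx, rfl⟩
      exact ⟨hx, rfl⟩
    · rintro ⟨x, _⟩ ⟨hx, -⟩
      exact ⟨x, hx, rfl⟩
  · change ExteriorAlgebra.map _ L.vec = ExteriorAlgebra.map (inl V (SympSpace.zero F)) L.vec *
      ExteriorAlgebra.map (inr V (SympSpace.zero F)) 1
    rw [map_one, mul_one]
    rfl

end OrientedLagrangian

section Monoidal

variable {F : Type} [Field F] [Fintype F] [DecidableEq F] {ψ : AddChar F ℂ}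

theorem canonicalMap_apply {V W : SympSpace F} (f : V ⟶ W) (v : canonicalSpace ψ W)
    (L : OrientedLagrangian V) (k : Heisenberg V) :
    ((canonicalMap ψ f v).1 L).1 k = (v.1 (L.map f)).1 (Heisenberg.map f k) := rfl

theorem tensorEquiv_tmul_apply (hF : ringChar F ≠ 2) (hψ : ψ ≠ 1) {V₁ V₂ : SympSpace F}
    (v : canonicalSpace ψ V₁) (w : canonicalSpace ψ V₂) (M₁ : OrientedLagrangian V₁)
    (M₂ : OrientedLagrangian V₂) (k : Heisenberg (V₁.prod V₂)) :
    ((tensorEquiv hF hψ V₁ V₂ (v ⊗ₜ w)).1 (M₁.prod M₂)).1 k =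
      ψ k.cen * ((v.1 M₁).1 (ofVec k.vec.1) * (w.1 M₂).1 (ofVec k.vec.2)) := by
  rw [tensorEquiv_tmul, box_apply]

/-- At `L₁ × L₂` both sides are the same product of values, because `f₁ × f₂` carries the product
orientation to the product orientation. -/
theorem canonicalMap_prodMap_tensorEquiv (hF : ringChar F ≠ 2) (hψ : ψ ≠ 1)
    {V₁ V₂ W₁ W₂ : SympSpace F} (f₁ : V₁ ⟶ W₁) (f₂ : V₂ ⟶ W₂) (v : canonicalSpace ψ W₁)
    (w : canonicalSpace ψ W₂) :
    canonicalMap ψ (prodMap f₁ f₂) (tensorEquiv hF hψ W₁ W₂ (v ⊗ₜ w)) =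
      tensorEquiv hF hψ V₁ V₂ (canonicalMap ψ f₁ v ⊗ₜ canonicalMap ψ f₂ w) := by
  obtain ⟨L₁⟩ := OrientedLagrangian.nonempty (Ring.two_ne_zero hF) V₁
  obtain ⟨L₂⟩ := OrientedLagrangian.nonempty (Ring.two_ne_zero hF) V₂
  refine canonicalSpace_ext hF hψ (L₁.prod L₂) fun k => ?_
  rw [canonicalMap_apply, prod_map, tensorEquiv_tmul_apply, tensorEquiv_tmul_apply]
  rfl

theorem canonicalMap_associator_tensorEquiv (hF : ringChar F ≠ 2) (hψ : ψ ≠ 1)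
    {V₁ V₂ V₃ : SympSpace F} (u : canonicalSpace ψ V₁) (v : canonicalSpace ψ V₂)
    (w : canonicalSpace ψ V₃) :
    canonicalMap ψ (α_ V₁ V₂ V₃).inv
        (tensorEquiv hF hψ (V₁.prod V₂) V₃ (tensorEquiv hF hψ V₁ V₂ (u ⊗ₜ v) ⊗ₜ w)) =
      tensorEquiv hF hψ V₁ (V₂.prod V₃) (u ⊗ₜ tensorEquiv hF hψ V₂ V₃ (v ⊗ₜ w)) := by
  obtain ⟨L₁⟩ := OrientedLagrangian.nonempty (Ring.two_ne_zero hF) V₁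
  obtain ⟨L₂⟩ := OrientedLagrangian.nonempty (Ring.two_ne_zero hF) V₂
  obtain ⟨L₃⟩ := OrientedLagrangian.nonempty (Ring.two_ne_zero hF) V₃
  refine canonicalSpace_ext hF hψ (L₁.prod (L₂.prod L₃)) fun k => ?_
  rw [canonicalMap_apply, prod_map_associator_inv]
  refine (tensorEquiv_tmul_apply hF hψ _ w _ _ _).trans ?_
  rw [tensorEquiv_tmul_apply, tensorEquiv_tmul_apply, tensorEquiv_tmul_apply, ofVec_cen, ofVec_cen,
    AddChar.map_zero_eq_one, one_mul, one_mul, mul_assoc]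
  rfl

/-- The model of the zero space is one-dimensional. -/
noncomputable def zeroModelEquiv (ψ : AddChar F ℂ) :
    ℂ ≃ₗ[ℂ] model ψ (OrientedLagrangian.zero F).space where
  toFun c := ⟨fun h => ψ h.cen * c, by
    refine ⟨fun z h => ?_, fun l hl h => ?_⟩
    · rw [← mul_assoc, ← AddChar.map_add_eq_mul]
      simp
    · obtain rfl : l = 0 := hl
      simp⟩
  map_add' c d := Subtype.ext (funext fun h => mul_add _ c d)
  map_smul' c d := Subtype.ext (funext fun h => mul_left_comm _ c d)
  invFun f := f.1 1
  left_inv c := by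
    change ψ 0 * c = c
    rw [AddChar.map_zero_eq_one, one_mul]
  right_inv f := Subtype.ext (funext fun h => (model_apply f h).symm)

/-- The unit isomorphism `ℂ ≃ ℋ(0)`. -/
noncomputable def unitEquiv (hF : ringChar F ≠ 2) (hψ : ψ ≠ 1) :
    ℂ ≃ₗ[ℂ] canonicalSpace ψ (SympSpace.zero F) :=
  (zeroModelEquiv ψ).trans (evalEquiv hF hψ (OrientedLagrangian.zero F)).symm

theorem unitEquiv_apply (hF : ringChar F ≠ 2) (hψ : ψ ≠ 1) (c : ℂ)
    (h : Heisenberg (SympSpace.zero F)) :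
    ((unitEquiv hF hψ c).1 (OrientedLagrangian.zero F)).1 h = ψ h.cen * c := by
  change (evalEquiv hF hψ (OrientedLagrangian.zero F) ((evalEquiv hF hψ _).symm
    (zeroModelEquiv ψ c))).1 h = _
  rw [LinearEquiv.apply_symm_apply]
  rfl

theorem canonicalMap_leftUnitor_tensorEquiv (hF : ringChar F ≠ 2) (hψ : ψ ≠ 1) {V : SympSpace F}
    (c : ℂ) (v : canonicalSpace ψ V) :
    canonicalMap ψ (λ_ V).inv (tensorEquiv hF hψ (SympSpace.zero F) V (unitEquiv hF hψ c ⊗ₜ v)) =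
      c • v := by
  obtain ⟨L⟩ := OrientedLagrangian.nonempty (Ring.two_ne_zero hF) V
  refine canonicalSpace_ext hF hψ L fun k => ?_
  rw [canonicalMap_apply, map_leftUnitor_inv]
  refine (tensorEquiv_tmul_apply hF hψ _ v _ _ _).trans ?_
  rw [unitEquiv_apply, ofVec_cen, AddChar.map_zero_eq_one, one_mul, mul_left_comm]
  exact congrArg (c * ·) (model_apply (v.1 L) k).symm

theorem canonicalMap_rightUnitor_tensorEquiv (hF : ringChar F ≠ 2) (hψ : ψ ≠ 1) {V : SympSpace F}
    (c : ℂ) (v : canonicalSpace ψ V) :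
    canonicalMap ψ (ρ_ V).inv (tensorEquiv hF hψ V (SympSpace.zero F) (v ⊗ₜ unitEquiv hF hψ c)) =
      c • v := by
  obtain ⟨L⟩ := OrientedLagrangian.nonempty (Ring.two_ne_zero hF) V
  refine canonicalSpace_ext hF hψ L fun k => ?_
  rw [canonicalMap_apply, map_rightUnitor_inv]
  refine (tensorEquiv_tmul_apply hF hψ v _ _ _ _).trans ?_
  rw [unitEquiv_apply, ofVec_cen, AddChar.map_zero_eq_one, one_mul, ← mul_assoc, mul_comm]
  exact congrArg (c * ·) (model_apply (v.1 L) k).symm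

/-- The monoidal structure on the quantization functor. -/
noncomputable def quantizationCoreMonoidal (hF : ringChar F ≠ 2) (hψ : ψ ≠ 1) :
    (quantization ψ).CoreMonoidal where
  εIso := (unitEquiv hF hψ).toFGModuleCatIso
  μIso X Y := (tensorEquiv hF hψ X.unop Y.unop).toFGModuleCatIso
  μIso_hom_natural_left {X Y} f X' := by
    refine FGModuleCat.hom_ext (TensorProduct.ext' fun v w => ?_)
    -- Whiskering is the product with an identity morphism.
    have h := canonicalMap_prodMap_tensorEquiv hF hψ f.unop (𝟙 X'.unop) v w
    rw [canonicalMap_id] at h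
    exact h.symm
  μIso_hom_natural_right {X Y} X' f := by
    refine FGModuleCat.hom_ext (TensorProduct.ext' fun v w => ?_)
    have h := canonicalMap_prodMap_tensorEquiv hF hψ (𝟙 X'.unop) f.unop v w
    rw [canonicalMap_id] at h
    exact h.symm
  associativity X Y Z := by
    refine FGModuleCat.hom_ext (TensorProduct.ext_threefold fun u v w => ?_)
    exact canonicalMap_associator_tensorEquiv hF hψ u v w
  left_unitality X := by
    refine FGModuleCat.hom_ext (TensorProduct.ext' fun c v => ?_)
    exact (canonicalMap_leftUnitor_tensorEquiv hF hψ c v).symm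
  right_unitality X := by
    refine FGModuleCat.hom_ext (TensorProduct.ext' fun v c => ?_)
    exact (canonicalMap_rightUnitor_tensorEquiv hF hψ c v).symm

theorem tensorEquiv_symm_comp_canonicalMap (hF : ringChar F ≠ 2) (hψ : ψ ≠ 1)
    {V₁ V₂ W₁ W₂ : SympSpace F} (f₁ : V₁ ⟶ W₁) (f₂ : V₂ ⟶ W₂) :
    (tensorEquiv hF hψ V₁ V₂).symm.toLinearMap ∘ₗ canonicalMap ψ (prodMap f₁ f₂) =
      TensorProduct.map (canonicalMap ψ f₁) (canonicalMap ψ f₂) ∘ₗ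
        (tensorEquiv hF hψ W₁ W₂).symm.toLinearMap := by
  have h : canonicalMap ψ (prodMap f₁ f₂) ∘ₗ (tensorEquiv hF hψ W₁ W₂).toLinearMap =
      (tensorEquiv hF hψ V₁ V₂).toLinearMap ∘ₗ
        TensorProduct.map (canonicalMap ψ f₁) (canonicalMap ψ f₂) :=
    TensorProduct.ext' fun v w => canonicalMap_prodMap_tensorEquiv hF hψ f₁ f₂ v w
  refine LinearMap.ext fun x => ?_
  obtain ⟨y, rfl⟩ := (tensorEquiv hF hψ W₁ W₂).surjective x
  have hy := LinearMap.congr_fun h y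
  simp only [LinearMap.comp_apply, LinearEquiv.coe_coe] at hy ⊢
  rw [hy, LinearEquiv.symm_apply_apply, LinearEquiv.symm_apply_apply]

theorem tensorEquiv_symm_comp_weilRep (hF : ringChar F ≠ 2) (hψ : ψ ≠ 1) (V₁ V₂ : SympSpace F)
    (g₁ : Sp V₁) (g₂ : Sp V₂) :
    (tensorEquiv hF hψ V₁ V₂).symm.toLinearMap ∘ₗ weilRep ψ (V₁.prod V₂) (Sp.prod V₁ V₂ (g₁, g₂)) =
      TensorProduct.map (weilRep ψ V₁ g₁) (weilRep ψ V₂ g₂) ∘ₗ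
        (tensorEquiv hF hψ V₁ V₂).symm.toLinearMap := by
  have h : Sp.toHom (Sp.prod V₁ V₂ (g₁, g₂))⁻¹ = prodMap (Sp.toHom g₁⁻¹) (Sp.toHom g₂⁻¹) := by
    rw [← map_inv]
    rfl
  change _ ∘ₗ canonicalMap ψ (Sp.toHom (Sp.prod V₁ V₂ (g₁, g₂))⁻¹) = _
  rw [h]
  exact tensorEquiv_symm_comp_canonicalMap hF hψ _ _

/-- The tensor product decomposition of the Weil representation of `Sp(V₁) × Sp(V₂)`. -/
noncomputable def weilRepProdEquiv (hF : ringChar F ≠ 2) (hψ : ψ ≠ 1) (V₁ V₂ : SympSpace F) :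
    Representation.Equiv ((weilRep ψ (V₁.prod V₂)).comp (Sp.prod V₁ V₂))
      (Representation.tprod ((weilRep ψ V₁).comp (MonoidHom.fst (Sp V₁) (Sp V₂)))
        ((weilRep ψ V₂).comp (MonoidHom.snd (Sp V₁) (Sp V₂)))) :=
  Representation.Equiv.mk (tensorEquiv hF hψ V₁ V₂).symm fun g =>
    tensorEquiv_symm_comp_weilRep hF hψ V₁ V₂ g.1 g.2

theorem weilRepProdEquiv_toLinearEquiv (hF : ringChar F ≠ 2) (hψ : ψ ≠ 1) (V₁ V₂ : SympSpace F) :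
    (weilRepProdEquiv hF hψ V₁ V₂).toLinearEquiv = (tensorEquiv hF hψ V₁ V₂).symm :=
  Representation.Equiv.toLinearEquiv_mk' _

/-- `α` starts from `ℋ(V₁ × V₂)`, so it is the oplax structure map `δ`, inverse to the lax map `μ`
given by `tensorEquiv`. -/
theorem quantizationCoreMonoidal_δ (hF : ringChar F ≠ 2) (hψ : ψ ≠ 1) (V₁ V₂ : SympSpace F) :
    letI := (quantizationCoreMonoidal hF hψ).toMonoidal
    Functor.OplaxMonoidal.δ (quantization ψ) (Opposite.op V₁) (Opposite.op V₂) =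
      FGModuleCat.ofHom (tensorEquiv hF hψ V₁ V₂).symm.toLinearMap := by
  change ((quantizationCoreMonoidal hF hψ).μIso (Opposite.op V₁) (Opposite.op V₂)).inv = _
  rfl

end Monoidal

end SympSpace

theorem proposition3 (F : Type) [Field F] [Fintype F] [DecidableEq F] (hF : ringChar F ≠ 2)
    (ψ : AddChar F ℂ) (hψ : ψ ≠ 1) :
    (∀ V : SympSpace F, ∃! T, SympSpace.IsCanonicalSystem ψ V T) ∧
    ∃ α : ∀ V₁ V₂ : SympSpace F, SympSpace.canonicalSpace ψ (V₁.prod V₂) ≃ₗ[ℂ]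
        SympSpace.canonicalSpace ψ V₁ ⊗[ℂ] SympSpace.canonicalSpace ψ V₂,
      (∀ (V₁ V₂ W₁ W₂ : SympSpace F) (f₁ : V₁ ⟶ W₁) (f₂ : V₂ ⟶ W₂),
        (α V₁ V₂).toLinearMap ∘ₗ SympSpace.canonicalMap ψ (SympSpace.prodMap f₁ f₂) =
          TensorProduct.map (SympSpace.canonicalMap ψ f₁) (SympSpace.canonicalMap ψ f₂) ∘ₗ
            (α W₁ W₂).toLinearMap) ∧
      (∃ _m : (SympSpace.quantization ψ).Monoidal, ∀ V₁ V₂ : SympSpace F,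
        Functor.OplaxMonoidal.δ (SympSpace.quantization ψ) (Opposite.op V₁) (Opposite.op V₂) =
          FGModuleCat.ofHom (α V₁ V₂).toLinearMap) ∧
      ∀ V₁ V₂ : SympSpace F, ∃ e : Representation.Equiv
          ((SympSpace.weilRep ψ (V₁.prod V₂)).comp (SympSpace.Sp.prod V₁ V₂))
          (Representation.tprod
            ((SympSpace.weilRep ψ V₁).comp (MonoidHom.fst (SympSpace.Sp V₁) (SympSpace.Sp V₂)))
            ((SympSpace.weilRep ψ V₂).comp (MonoidHom.snd (SympSpace.Sp V₁) (SympSpace.Sp V₂)))),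
        e.toLinearEquiv = α V₁ V₂ := by
  refine ⟨SympSpace.existsUnique_isCanonicalSystem hF hψ,
    fun V₁ V₂ => (SympSpace.tensorEquiv hF hψ V₁ V₂).symm,
    fun V₁ V₂ W₁ W₂ f₁ f₂ => SympSpace.tensorEquiv_symm_comp_canonicalMap hF hψ f₁ f₂,
    ⟨(SympSpace.quantizationCoreMonoidal hF hψ).toMonoidal,
      SympSpace.quantizationCoreMonoidal_δ hF hψ⟩,
    fun V₁ V₂ => ⟨SympSpace.weilRepProdEquiv hF hψ V₁ V₂,
      SympSpace.weilRepProdEquiv_toLinearEquiv hF hψ V₁ V₂⟩⟩
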